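/- Let $(M^2,\bar g)$ and $(N^3,h)$ be smooth Riemannian manifolds (without boundary) of dimensions $2$ and $3$, let $\varphi:M\to N$ be a smooth immersion, and let $\lambda:M\to\mathbb R$ be a function with $\varphi^*h=\lambda^2\bar g$ (so $\lambda^2$ is smooth and positive). Put $g=\varphi^*h=\lambda^2\bar g$. For a smooth map $\phi:(M,g)\to(N,h)$ let $\tau(\phi)=\mathrm{Trace}_g\nabla d\phi$ be the tension field and $$\tau_2(\phi)=\mathrm{Trace}_g\big(\nabla^\phi\nabla^\phi-\nabla^\phi_{\nabla^M}\big)\tau(\phi)-\mathrm{Trace}_g\,R^N(d\phi,\tau(\phi))\,d\phi ,\qquad R^N(X,Y)Z=[\nabla^N_X,\nabla^N_Y]Z-\nabla^N_{[X,Y]}Z,$$ the bitension field. The map $\phi$ is called biharmonic if it solves the biharmonic map equation $\tau_2(\phi)=0$ and, for a positive function $f$ on $M$, $f$-biharmonic if it solves the $f$-biharmonic map equation $f\,\tau_2(\phi)+(\Delta f)\,\tau(\phi)+2\nabla^\phi_{\mathrm{grad} f}\tau(\phi)=0$ (the Euler–Lagrange equations of the bienergy $\frac12\int|\tau(\phi)|^2v_g$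 and of the $f$-bienergy $\frac12\int f|\tau(\phi)|^2v_g$). Then $\varphi:(M,\bar g)\to(N,h)$ is biharmonic if and only if the surface, i.e. the isometric immersion $\varphi:(M,g)\to(N,h)$, is $f$-biharmonic with $f=\lambda^2$. Moreover, this holds if and only if, for every smooth unit normal vector field $\xi$ of $\varphi$ over an open subset of $M$, one has on this subset $$\begin{cases}\Delta(\lambda^2H)-\lambda^2H\,\big(|A|^2-\mathrm{Ric}^N(\xi,\xi)\big)=0,\\[2pt] A(\mathrm{grad}(\lambda^2H))+\lambda^2H\,\big(\mathrm{grad}\,H-(\mathrm{Ric}^N\xi)^\top\big)=0;\end{cases}$$ and if there is a global smooth unit normal vector field $\xi$ on $M$, it holds if and only if this system is satisfied on $M$ for that $\xi$. Here $A$ is the shape operator, $g(AX,Y)=-h(\nabla^\varphi_X\xi,d\varphi(Y))$, $H=\frac12\,\mathrm{trace}\,A$ is the mean curvature function, $\mathrm{Ric}^N$ is the Ricci tensor of $(N,h)$ (and its Ricci operator), $(\cdot)^\top$ is the tangential part, and $\Delta$, $\mathrm{grad}$ and $|\cdot|$ are taken with respect to the induced metric $g$. -/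

import Mathlib

open scoped Manifold ContDiff

noncomputable section

namespace BiharmonicSurface

/-- Coordinate space `ℝⁿ`. -/
abbrev Coord (n : ℕ) : Type := EuclideanSpace ℝ (Fin n)

/-! ### Local Riemannian geometry in coordinates

`G : Coord m → Matrix` is the matrix `(g_ij)` of a metric in a chart of the source, `K` is the matrix
`(h_ab)` of a metric in a chart of the target, and `F : Coord m → Coord n` is a map read in these
charts. Vector fields along `F` are given by their components `V x a`. -/

/-- The partial derivative `∂_i u` at `x`. -/
def pd {m : ℕ} (i : Fin m) (u : Coord m → ℝ) (x : Coord m) : ℝ :=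
  fderiv ℝ u x (EuclideanSpace.single i 1)

/-- The Christoffel symbol `Γ^k_ij = ½ g^{kl} (∂_i g_jl + ∂_j g_il - ∂_l g_ij)` of the Levi-Civita
connection of `G` at `x`. -/
def christoffel {m : ℕ} (G : Coord m → Matrix (Fin m) (Fin m) ℝ) (x : Coord m) (k i j : Fin m) : ℝ :=
  1 / 2 * ∑ l, (G x)⁻¹ k l *
    (pd i (fun y => G y j l) x + pd j (fun y => G y i l) x - pd l (fun y => G y i j) x)

/-- The components of the curvature operator `R(X,Y)Z = [∇_X,∇_Y]Z - ∇_[X,Y] Z`: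
`R(∂_i,∂_j)∂_k = ∑ l, riemann G x l k i j • ∂_l`. -/
def riemann {m : ℕ} (G : Coord m → Matrix (Fin m) (Fin m) ℝ) (x : Coord m) (l k i j : Fin m) : ℝ :=
  pd i (fun y => christoffel G y l j k) x - pd j (fun y => christoffel G y l i k) x
    + ∑ s, (christoffel G x l i s * christoffel G x s j k
      - christoffel G x l j s * christoffel G x s i k)

/-- The Ricci curvature `Ric(∂_j,∂_k) = trace (X ↦ R(X,∂_j)∂_k)` (positive on round spheres). -/
def ricci {m : ℕ} (G : Coord m → Matrix (Fin m) (Fin m) ℝ) (x : Coord m) (j k : Fin m) : ℝ :=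
  ∑ i, riemann G x i k i j

/-- The components `g^{kl} ∂_l u` of the gradient of a function. -/
def grad {m : ℕ} (G : Coord m → Matrix (Fin m) (Fin m) ℝ) (u : Coord m → ℝ) (x : Coord m)
    (k : Fin m) : ℝ :=
  ∑ l, (G x)⁻¹ k l * pd l u x

/-- The Laplace-Beltrami operator `Δu = g^{ij} (∂_i ∂_j u - Γ^k_ij ∂_k u)` on functions. -/
def laplacian {m : ℕ} (G : Coord m → Matrix (Fin m) (Fin m) ℝ) (u : Coord m → ℝ)
    (x : Coord m) : ℝ :=
  ∑ i, ∑ j, (G x)⁻¹ i j * (pd i (pd j u) x - ∑ k, christoffel G x k i j * pd k u x)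

/-- The components `∂_j F^a` of the vector field `dF(∂_j)` along `F`. -/
def dMap {m n : ℕ} (F : Coord m → Coord n) (j : Fin m) (x : Coord m) (a : Fin n) : ℝ :=
  pd j (fun y => F y a) x

/-- The pull-back connection `∇^F`: the components
`(∇^F_{∂_i} V)^a = ∂_i V^a + Γ^a_bc(F) ∂_i F^b V^c`, for a vector field `V` along `F`. -/
def covAlong {m n : ℕ} (K : Coord n → Matrix (Fin n) (Fin n) ℝ) (F : Coord m → Coord n)
    (V : Coord m → Fin n → ℝ) (i : Fin m) (x : Coord m) (a : Fin n) : ℝ :=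
  pd i (fun y => V y a) x + ∑ b, ∑ c, christoffel K (F x) a b c * dMap F i x b * V x c

/-- The tension field `τ(F) = Trace_g ∇dF = g^{ij} (∇^F_{∂_i} dF(∂_j) - Γ^k_ij dF(∂_k))`. -/
def tension {m n : ℕ} (G : Coord m → Matrix (Fin m) (Fin m) ℝ)
    (K : Coord n → Matrix (Fin n) (Fin n) ℝ) (F : Coord m → Coord n) (x : Coord m)
    (a : Fin n) : ℝ :=
  ∑ i, ∑ j, (G x)⁻¹ i j *
    (covAlong K F (dMap F j) i x a - ∑ k, christoffel G x k i j * dMap F k x a)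

/-- The rough Laplacian `Trace_g (∇^F ∇^F - ∇^F_{∇^M}) V` on vector fields along `F`. -/
def roughLaplacian {m n : ℕ} (G : Coord m → Matrix (Fin m) (Fin m) ℝ)
    (K : Coord n → Matrix (Fin n) (Fin n) ℝ) (F : Coord m → Coord n)
    (V : Coord m → Fin n → ℝ) (x : Coord m) (a : Fin n) : ℝ :=
  ∑ i, ∑ j, (G x)⁻¹ i j *
    (covAlong K F (covAlong K F V j) i x a - ∑ k, christoffel G x k i j * covAlong K F V k x a)

/-- The bitension field
`τ₂(F) = Trace_g (∇^F ∇^F - ∇^F_{∇^M}) τ(F) - Trace_g R^N(dF, τ(F)) dF`. -/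
def bitension {m n : ℕ} (G : Coord m → Matrix (Fin m) (Fin m) ℝ)
    (K : Coord n → Matrix (Fin n) (Fin n) ℝ) (F : Coord m → Coord n) (x : Coord m)
    (a : Fin n) : ℝ :=
  roughLaplacian G K F (tension G K F) x a
    - ∑ i, ∑ j, (G x)⁻¹ i j * ∑ b, ∑ c, ∑ d,
        riemann K (F x) a b c d * dMap F i x c * tension G K F x d * dMap F j x b

/-- The `f`-bitension field `τ_{2,f}(F) = f τ₂(F) + (Δf) τ(F) + 2 ∇^F_{grad f} τ(F)`. -/
def fBitension {m n : ℕ} (G : Coord m → Matrix (Fin m) (Fin m) ℝ)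
    (K : Coord n → Matrix (Fin n) (Fin n) ℝ) (f : Coord m → ℝ) (F : Coord m → Coord n)
    (x : Coord m) (a : Fin n) : ℝ :=
  f x * bitension G K F x a + laplacian G f x * tension G K F x a
    + 2 * ∑ k, grad G f x k * covAlong K F (tension G K F) k x a

/-- The shape operator of a hypersurface `F` with unit normal field `ν`, i.e. the operator `A` with
`g(A X, Y) = -h(∇^F_X ν, dF(Y))`. Its matrix is given by `A ∂_i = ∑ k, shape G K F ν x k i • ∂_k`. -/
def shape {m n : ℕ} (G : Coord m → Matrix (Fin m) (Fin m) ℝ)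
    (K : Coord n → Matrix (Fin n) (Fin n) ℝ) (F : Coord m → Coord n)
    (ν : Coord m → Fin n → ℝ) (x : Coord m) (k i : Fin m) : ℝ :=
  -∑ j, (G x)⁻¹ k j * ∑ a, ∑ b, K (F x) a b * covAlong K F ν i x a * dMap F j x b

/-- The mean curvature function `H = (1/m) trace A`. -/
def meanCurvature {m n : ℕ} (G : Coord m → Matrix (Fin m) (Fin m) ℝ)
    (K : Coord n → Matrix (Fin n) (Fin n) ℝ) (F : Coord m → Coord n)
    (ν : Coord m → Fin n → ℝ) (x : Coord m) : ℝ :=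
  1 / (m : ℝ) * ∑ i, shape G K F ν x i i

/-- The squared norm `|A|² = g^{ij} g_{kl} A^k_i A^l_j` of the shape operator. -/
def shapeNormSq {m n : ℕ} (G : Coord m → Matrix (Fin m) (Fin m) ℝ)
    (K : Coord n → Matrix (Fin n) (Fin n) ℝ) (F : Coord m → Coord n)
    (ν : Coord m → Fin n → ℝ) (x : Coord m) : ℝ :=
  ∑ i, ∑ j, ∑ k, ∑ l,
    (G x)⁻¹ i j * G x k l * shape G K F ν x k i * shape G K F ν x l j

/-- The function `Ric^N(ν,ν)`. -/
def ricciNormal {m n : ℕ} (K : Coord n → Matrix (Fin n) (Fin n) ℝ) (F : Coord m → Coord n)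
    (ν : Coord m → Fin n → ℝ) (x : Coord m) : ℝ :=
  ∑ a, ∑ b, ricci K (F x) a b * ν x a * ν x b

/-- The tangential part `(Ric^N(ν))^⊤` of the Ricci operator applied to `ν`: the tangent vector `T`
with `g(T, Y) = h(Ric^N(ν), dF(Y)) = Ric^N(ν, dF(Y))`, so `T^k = g^{kl} Ric^N(ν, dF(∂_l))`. -/
def ricciTangent {m n : ℕ} (G : Coord m → Matrix (Fin m) (Fin m) ℝ)
    (K : Coord n → Matrix (Fin n) (Fin n) ℝ) (F : Coord m → Coord n)
    (ν : Coord m → Fin n → ℝ) (x : Coord m) (k : Fin m) : ℝ :=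
  ∑ l, (G x)⁻¹ k l * ∑ a, ∑ b, ricci K (F x) a b * ν x a * dMap F l x b

/-- In coordinates, at `x`, the system
`Δ(f H) - f H (|A|² - Ric^N(ν,ν)) = 0`, `A(grad(f H)) + f H (grad H - (Ric^N(ν))^⊤) = 0`. -/
def SystemAt {m n : ℕ} (G : Coord m → Matrix (Fin m) (Fin m) ℝ)
    (K : Coord n → Matrix (Fin n) (Fin n) ℝ) (f : Coord m → ℝ) (F : Coord m → Coord n)
    (ν : Coord m → Fin n → ℝ) (x : Coord m) : Prop :=
  laplacian G (fun y => f y * meanCurvature G K F ν y) x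
      - f x * meanCurvature G K F ν x * (shapeNormSq G K F ν x - ricciNormal K F ν x) = 0 ∧
  ∀ k, ∑ i, shape G K F ν x k i * grad G (fun y => f y * meanCurvature G K F ν y) x i
      + f x * meanCurvature G K F ν x
        * (grad G (meanCurvature G K F ν) x k - ricciTangent G K F ν x k) = 0

/-! ### Manifolds -/

section Manifolds

variable {m n : ℕ}
variable {M : Type*} [TopologicalSpace M] [ChartedSpace (Coord m) M]
variable {N : Type*} [TopologicalSpace N] [ChartedSpace (Coord n) N]

/-- A field of real-valued forms in two tangent vectors; it is only used for Riemannian metrics. -/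
abbrev MetricField (m : ℕ) (M : Type*) [TopologicalSpace M] [ChartedSpace (Coord m) M] : Type _ :=
  ∀ p : M, TangentSpace (𝓡 m) p → TangentSpace (𝓡 m) p → ℝ

/-- The field of inner products of a smooth Riemannian metric. -/
def metricField [IsManifold (𝓡 m) ∞ M]
    (g : Bundle.ContMDiffRiemannianMetric (𝓡 m) ∞ (Coord m)
      (fun p : M => TangentSpace (𝓡 m) p)) : MetricField m M :=
  fun p v w => g.inner p v w

/-- The pull-back `φ^* h`, i.e. `(φ^* h)_p(v, w) = h_{φ(p)}(dφ_p v, dφ_p w)`. -/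
def pullbackMetric (m : ℕ) {M : Type*} [TopologicalSpace M] [ChartedSpace (Coord m) M]
    (h : MetricField n N) (φ : M → N) : MetricField m M := fun p v w =>
  h (φ p) (mfderiv (𝓡 m) (𝓡 n) φ p v) (mfderiv (𝓡 m) (𝓡 n) φ p w)

/-- The matrix `g_ij = g(∂_i, ∂_j)` of a metric in the chart `e`, as a function of the
coordinates. -/
def metricInChart (g : MetricField m M) (e : OpenPartialHomeomorph M (Coord m)) (x : Coord m) :
    Matrix (Fin m) (Fin m) ℝ := fun i j =>
  g (e.symm x) (mfderiv (𝓡 m) (𝓡 m) e.symm x (EuclideanSpace.single i (1 : ℝ)))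
    (mfderiv (𝓡 m) (𝓡 m) e.symm x (EuclideanSpace.single j (1 : ℝ)))

/-- The map `φ` read in the charts `e` of `M` and `e'` of `N`. -/
def mapInCharts (φ : M → N) (e : OpenPartialHomeomorph M (Coord m))
    (e' : OpenPartialHomeomorph N (Coord n)) : Coord m → Coord n :=
  fun x => e' (φ (e.symm x))

/-- The components, in the chart `e'` of `N`, of a vector field `ξ` along `φ`, as functions of the
coordinates in the chart `e` of `M`. -/
def fieldInCharts (φ : M → N) (ξ : ∀ p : M, TangentSpace (𝓡 n) (φ p))
    (e : OpenPartialHomeomorph M (Coord m)) (e' : OpenPartialHomeomorph N (Coord n))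
    (x : Coord m) (a : Fin n) : ℝ :=
  (show Coord n from mfderiv (𝓡 n) (𝓡 n) e' (φ (e.symm x)) (ξ (e.symm x))) a

/-- A map `φ : (M, g) → (N, h)` is biharmonic if its bitension field vanishes, in all local
coordinates around all points. -/
def IsBiharmonic (g : MetricField m M) (h : MetricField n N) (φ : M → N) : Prop :=
  ∀ e ∈ IsManifold.maximalAtlas (𝓡 m) ∞ M, ∀ e' ∈ IsManifold.maximalAtlas (𝓡 n) ∞ N,
    ∀ p ∈ e.source, φ p ∈ e'.source →
      ∀ a, bitension (metricInChart g e) (metricInChart h e') (mapInCharts φ e e') (e p) a = 0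

/-- A map `φ : (M, g) → (N, h)` is `f`-biharmonic if its `f`-bitension field vanishes, in all local
coordinates around all points. -/
def IsFBiharmonic (g : MetricField m M) (h : MetricField n N) (f : M → ℝ) (φ : M → N) : Prop :=
  ∀ e ∈ IsManifold.maximalAtlas (𝓡 m) ∞ M, ∀ e' ∈ IsManifold.maximalAtlas (𝓡 n) ∞ N,
    ∀ p ∈ e.source, φ p ∈ e'.source →
      ∀ a, fBitension (metricInChart g e) (metricInChart h e') (f ∘ e.symm) (mapInCharts φ e e')
        (e p) a = 0

/-- `ξ` is a smooth unit normal vector field of the immersion `φ` over the set `U`. -/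
structure IsUnitNormalOn (m : ℕ) {M : Type*} [TopologicalSpace M] [ChartedSpace (Coord m) M]
    [IsManifold (𝓡 n) ∞ N] (h : MetricField n N) (φ : M → N)
    (ξ : ∀ p : M, TangentSpace (𝓡 n) (φ p)) (U : Set M) : Prop where
  smooth : ContMDiffOn (𝓡 m) (𝓡 n).tangent ∞
    (fun p => (⟨φ p, ξ p⟩ : TangentBundle (𝓡 n) N)) U
  unit : ∀ p ∈ U, h (φ p) (ξ p) (ξ p) = 1
  normal : ∀ p ∈ U, ∀ v : TangentSpace (𝓡 m) p, h (φ p) (ξ p) (mfderiv (𝓡 m) (𝓡 n) φ p v) = 0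

/-- The system `Δ(f H) - f H (|A|² - Ric^N(ξ,ξ)) = 0`,
`A(grad(f H)) + f H (grad H - (Ric^N(ξ))^⊤) = 0` for the immersion `φ : (M, g) → (N, h)` with unit
normal field `ξ`, over the set `U`; all operators on `M` are those of the metric `g`. -/
def SystemOn (g : MetricField m M) (h : MetricField n N) (f : M → ℝ) (φ : M → N)
    (ξ : ∀ p : M, TangentSpace (𝓡 n) (φ p)) (U : Set M) : Prop :=
  ∀ e ∈ IsManifold.maximalAtlas (𝓡 m) ∞ M, ∀ e' ∈ IsManifold.maximalAtlas (𝓡 n) ∞ N,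
    ∀ p ∈ e.source ∩ U, φ p ∈ e'.source →
      SystemAt (metricInChart g e) (metricInChart h e') (f ∘ e.symm) (mapInCharts φ e e')
        (fieldInCharts φ ξ e e') (e p)

end Manifolds

end BiharmonicSurface

end

/-! Write `J_g V = Trace_g (∇∇ - ∇_∇) V - Trace_g R(dφ, V) dφ`. Then `τ₂ = J_g(τ)` by definition,
and the Leibniz rule for the rough Laplacian gives `τ_{2,f} = J_g(f τ)`.

On a surface, conformal metrics `g = f ḡ` have proportional traces: `ḡ^{ij} (A_ij - Γ̄^k_ij B_k) = f
g^{ij} (A_ij - Γ^k_ij B_k)` for all `A`, `B`, because the `ḡ`-trace of the change of the Christoffel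
symbols carries the factor `2 - m`, which vanishes for `m = 2` (`sum_inv_smul_sub_conformal`).
Applied to the tension field and to the rough Laplacian, this gives `τ₂(φ, ḡ) = J_ḡ(f τ_g) = f J_g(f
τ_g) = f τ_{2,f}(φ, g)` (`bitension_conformal`). Since `f = λ²` is positive, the first equivalence
follows.

For the isometric immersion `τ = 2 H ν`, so `τ_{2,f} = J_g(2 f H ν)`. The components of `J_g(u ν)`
follow from the Gauss and Weingarten formulas, the traced Codazzi equation and the symmetries of the
curvature (`jacobiOp_smul_normal`, `jacobiOp_smul_tangent`). The vectors `∂_0 F, ∂_1 F, ν` form a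
basis, so vanishing of the field is vanishing of these components, and that is the system.

The equations on manifolds are imposed in every pair of charts, so both equivalences are proved at a
point in a fixed pair of charts. A unit normal always exists locally (`exists_isUnitNormalOn`), so
no orientability is needed. -/

noncomputable section

namespace BiharmonicSurface

/-! ### Calculus of partial derivatives -/

section Calculus

variable {m n : ℕ} {i j : Fin m} {u v : Coord m → ℝ} {x : Coord m} {s : Set (Coord m)}

theorem pd_congr (h : u =ᶠ[nhds x] v) : pd i u x = pd i v x := by
  simp only [pd, h.fderiv_eq]

theorem pd_congr_of_eqOn (hs : IsOpen s) (hx : x ∈ s) (h : Set.EqOn u v s) :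
    pd i u x = pd i v x :=
  pd_congr (Filter.eventuallyEq_of_mem (hs.mem_nhds hx) h)

theorem differentiableAt_of_contDiffOn {E F : Type*} [NormedAddCommGroup E] [NormedSpace ℝ E]
    [NormedAddCommGroup F] [NormedSpace ℝ F] {f : E → F} {t : Set E} {y : E}
    (hf : ContDiffOn ℝ ∞ f t) (ht : IsOpen t) (hy : y ∈ t) : DifferentiableAt ℝ f y :=
  (hf.contDiffAt (ht.mem_nhds hy)).differentiableAt (by simp)

theorem pd_const (c : ℝ) : pd i (fun _ => c) x = 0 := by simp [pd]

theorem pd_add (hu : DifferentiableAt ℝ u x) (hv : DifferentiableAt ℝ v x) :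
    pd i (fun y => u y + v y) x = pd i u x + pd i v x := by
  simp [pd, fderiv_fun_add hu hv]

theorem pd_mul (hu : DifferentiableAt ℝ u x) (hv : DifferentiableAt ℝ v x) :
    pd i (fun y => u y * v y) x = pd i u x * v x + u x * pd i v x := by
  simp [pd, fderiv_fun_mul hu hv]; ring

theorem pd_const_mul (c : ℝ) (hu : DifferentiableAt ℝ u x) :
    pd i (fun y => c * u y) x = c * pd i u x := by
  simp [pd, fderiv_const_mul hu c]

theorem pd_neg : pd i (fun y => -u y) x = -pd i u x := by
  simp [pd, fderiv_fun_neg]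

theorem pd_sum {ι : Type*} {t : Finset ι} {w : ι → Coord m → ℝ}
    (hw : ∀ k ∈ t, DifferentiableAt ℝ (w k) x) :
    pd i (fun y => ∑ k ∈ t, w k y) x = ∑ k ∈ t, pd i (w k) x := by
  simp [pd, fderiv_fun_sum hw]

theorem pd_sum_mul {ι : Type*} {t : Finset ι} {w z : ι → Coord m → ℝ}
    (hw : ∀ k ∈ t, DifferentiableAt ℝ (w k) x) (hz : ∀ k ∈ t, DifferentiableAt ℝ (z k) x) :
    pd i (fun y => ∑ k ∈ t, w k y * z k y) x
      = ∑ k ∈ t, (pd i (w k) x * z k x + w k x * pd i (z k) x) := by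
  rw [pd_sum fun k hk => (hw k hk).fun_mul (hz k hk)]
  exact Finset.sum_congr rfl fun k hk => pd_mul (hw k hk) (hz k hk)

theorem contDiffOn_pd (hs : IsOpen s) (hu : ContDiffOn ℝ ∞ u s) (i : Fin m) :
    ContDiffOn ℝ ∞ (pd i u) s :=
  (hu.fderiv_of_isOpen hs (by simp)).clm_apply contDiffOn_const

/-- Both sides are values of the second Fréchet derivative, which is symmetric. -/
theorem pd_comm (hs : IsOpen s) (hu : ContDiffOn ℝ ∞ u s) (hx : x ∈ s) :
    pd i (pd j u) x = pd j (pd i u) x := by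
  have hd : DifferentiableAt ℝ (fderiv ℝ u) x :=
    differentiableAt_of_contDiffOn (hu.fderiv_of_isOpen hs (m := ∞) (by simp)) hs hx
  have hsymm : IsSymmSndFDerivAt ℝ u x :=
    (hu.contDiffAt (hs.mem_nhds hx)).isSymmSndFDerivAt
      (by simpa using (WithTop.coe_le_coe.2 (le_top : (2 : ℕ∞) ≤ ⊤)))
  have key : ∀ k l : Fin m, pd k (pd l u) x
      = fderiv ℝ (fderiv ℝ u) x (EuclideanSpace.single k 1) (EuclideanSpace.single l 1) := by
    intro k l
    change fderiv ℝ (fun y => fderiv ℝ u y (EuclideanSpace.single l 1)) x _ = _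
    rw [fderiv_clm_apply hd (differentiableAt_const _)]
    simp
  rw [key, key, hsymm.eq]

theorem coord_eq_sum {n : ℕ} (v : Coord n) : v = ∑ b, v b • EuclideanSpace.single b (1 : ℝ) := by
  have := (EuclideanSpace.basisFun (Fin n) ℝ).sum_repr v
  simpa using this.symm

theorem dMap_apply {F : Coord m → Coord n} (hF : DifferentiableAt ℝ F x) (b : Fin n) :
    dMap F i x b = fderiv ℝ F x (EuclideanSpace.single i 1) b := by
  have := ((EuclideanSpace.proj (𝕜 := ℝ) b).hasFDerivAt (x := F x)).comp x hF.hasFDerivAt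
  simp only [dMap, pd]
  change fderiv ℝ ((EuclideanSpace.proj (𝕜 := ℝ) b) ∘ F) x _ = _
  rw [this.fderiv]; simp

theorem pd_comp {F : Coord m → Coord n} {k : Coord n → ℝ}
    (hk : DifferentiableAt ℝ k (F x)) (hF : DifferentiableAt ℝ F x) :
    pd i (fun y => k (F y)) x = ∑ b, pd b k (F x) * dMap F i x b := by
  have h1 : pd i (fun y => k (F y)) x
      = fderiv ℝ k (F x) (fderiv ℝ F x (EuclideanSpace.single i 1)) := by
    have := fderiv_comp (𝕜 := ℝ) x hk hF
    simp only [pd]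
    change fderiv ℝ (k ∘ F) x _ = _
    rw [this]; rfl
  rw [h1, coord_eq_sum (fderiv ℝ F x _), map_sum]
  simp [dMap_apply hF, pd, mul_comm]

theorem contDiffOn_apply {F : Coord m → Coord n} (hF : ContDiffOn ℝ ∞ F s) (a : Fin n) :
    ContDiffOn ℝ ∞ (fun y => F y a) s :=
  (EuclideanSpace.proj (𝕜 := ℝ) a).contDiff.comp_contDiffOn hF

theorem contDiffOn_dMap (hs : IsOpen s) {F : Coord m → Coord n} (hF : ContDiffOn ℝ ∞ F s)
    (i : Fin m) (a : Fin n) : ContDiffOn ℝ ∞ (fun y => dMap F i y a) s :=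
  contDiffOn_pd hs (contDiffOn_apply hF a) i

theorem pd_dMap_comm (hs : IsOpen s) {F : Coord m → Coord n} (hF : ContDiffOn ℝ ∞ F s)
    (hx : x ∈ s) (a : Fin n) :
    pd i (fun y => dMap F j y a) x = pd j (fun y => dMap F i y a) x :=
  pd_comm hs (contDiffOn_apply hF a) hx

end Calculus

/-! ### Inner products -/

section Bil

variable {n : ℕ}

/-- The bilinear form with Gram matrix `B`. -/
def bil (B : Matrix (Fin n) (Fin n) ℝ) : (Fin n → ℝ) →ₗ[ℝ] (Fin n → ℝ) →ₗ[ℝ] ℝ :=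
  Matrix.toLinearMap₂' ℝ B

theorem bil_apply (B : Matrix (Fin n) (Fin n) ℝ) (v w : Fin n → ℝ) :
    bil B v w = ∑ a, ∑ b, B a b * v a * w b := by
  simp only [bil, Matrix.toLinearMap₂'_apply, smul_eq_mul]
  exact Finset.sum_congr rfl fun a _ => Finset.sum_congr rfl fun b _ => by ring

theorem bil_comm {B : Matrix (Fin n) (Fin n) ℝ} (hB : ∀ a b, B a b = B b a) (v w : Fin n → ℝ) :
    bil B v w = bil B w v := by
  rw [bil_apply, bil_apply, Finset.sum_comm]
  exact Finset.sum_congr rfl fun a _ => Finset.sum_congr rfl fun b _ => by rw [hB]; ring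

theorem bil_pos {B : Matrix (Fin n) (Fin n) ℝ} (hB : B.PosDef) {v : Fin n → ℝ} (hv : v ≠ 0) :
    0 < bil B v v := by
  have := hB.dotProduct_mulVec_pos hv
  simp only [star_trivial, dotProduct, Matrix.mulVec, Finset.mul_sum] at this
  rw [bil_apply]
  refine this.trans_eq (Finset.sum_congr rfl fun a _ => Finset.sum_congr rfl fun b _ => ?_)
  ring

theorem bil_mulVec (B : Matrix (Fin n) (Fin n) ℝ) (v w : Fin n → ℝ) :
    bil B v w = v ⬝ᵥ B.mulVec w := by
  simp only [bil_apply, dotProduct, Matrix.mulVec, Finset.mul_sum]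
  exact Finset.sum_congr rfl fun a _ => Finset.sum_congr rfl fun b _ => by ring

end Bil

/-! ### Riemannian metrics on open sets of coordinate space -/

section Metric

/-- `K` is a smooth Riemannian metric on the open set `W`. -/
structure IsMetricOn {n : ℕ} (K : Coord n → Matrix (Fin n) (Fin n) ℝ) (W : Set (Coord n)) :
    Prop where
  isOpen : IsOpen W
  smooth : ∀ a b, ContDiffOn ℝ ∞ (fun y => K y a b) W
  posDef : ∀ y ∈ W, (K y).PosDef

variable {n : ℕ} {K : Coord n → Matrix (Fin n) (Fin n) ℝ} {W : Set (Coord n)}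

theorem IsMetricOn.symm (hK : IsMetricOn K W) {y : Coord n} (hy : y ∈ W) (a b : Fin n) :
    K y a b = K y b a := by
  simpa using ((hK.posDef y hy).isHermitian.apply a b).symm

theorem IsMetricOn.inv_symm (hK : IsMetricOn K W) {y : Coord n} (hy : y ∈ W) (a b : Fin n) :
    (K y)⁻¹ a b = (K y)⁻¹ b a := by
  simpa using ((hK.posDef y hy).isHermitian.inv.apply a b).symm

theorem IsMetricOn.isUnit_det (hK : IsMetricOn K W) {y : Coord n} (hy : y ∈ W) :
    IsUnit (K y).det := (hK.posDef y hy).det_pos.ne'.isUnit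

theorem IsMetricOn.inv_mul (hK : IsMetricOn K W) {y : Coord n} (hy : y ∈ W) :
    (K y)⁻¹ * K y = 1 := Matrix.nonsing_inv_mul _ (hK.isUnit_det hy)

theorem IsMetricOn.mul_inv (hK : IsMetricOn K W) {y : Coord n} (hy : y ∈ W) :
    K y * (K y)⁻¹ = 1 := Matrix.mul_nonsing_inv _ (hK.isUnit_det hy)

theorem contDiffOn_det {E ι : Type*} [NormedAddCommGroup E] [NormedSpace ℝ E] [Fintype ι]
    [DecidableEq ι] {A : E → Matrix ι ι ℝ} {s : Set E}
    (hA : ∀ a b, ContDiffOn ℝ ∞ (fun y => A y a b) s) : ContDiffOn ℝ ∞ (fun y => (A y).det) s := by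
  simp only [Matrix.det_apply, Units.smul_def, zsmul_eq_mul]
  exact ContDiffOn.sum fun σ _ => contDiffOn_const.mul (contDiffOn_prod fun i _ => hA _ _)

/-- Cramer's rule: an entry of the inverse is a quotient of determinants, hence a rational function
of the entries. -/
theorem contDiffOn_inv {E ι : Type*} [NormedAddCommGroup E] [NormedSpace ℝ E] [Fintype ι]
    [DecidableEq ι] {A : E → Matrix ι ι ℝ} {s : Set E}
    (hA : ∀ a b, ContDiffOn ℝ ∞ (fun y => A y a b) s) (hd : ∀ y ∈ s, (A y).det ≠ 0) (a b : ι) :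
    ContDiffOn ℝ ∞ (fun y => (A y)⁻¹ a b) s := by
  simp only [Matrix.inv_def, Ring.inverse_eq_inv', Matrix.smul_apply, smul_eq_mul,
    Matrix.adjugate_apply]
  refine ((contDiffOn_det hA).inv hd).mul (contDiffOn_det fun c d => ?_)
  by_cases h : c = b
  · subst h; simpa using contDiffOn_const
  · simpa [Matrix.updateRow_ne h] using hA c d

theorem IsMetricOn.smooth_inv (hK : IsMetricOn K W) (a b : Fin n) :
    ContDiffOn ℝ ∞ (fun y => (K y)⁻¹ a b) W :=
  contDiffOn_inv hK.smooth (fun y hy => (hK.posDef y hy).det_pos.ne') a b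

theorem IsMetricOn.smooth_christoffel (hK : IsMetricOn K W) (a b c : Fin n) :
    ContDiffOn ℝ ∞ (fun y => christoffel K y a b c) W := by
  refine contDiffOn_const.mul (ContDiffOn.sum fun l _ => (hK.smooth_inv a l).mul ?_)
  exact ((contDiffOn_pd hK.isOpen (hK.smooth _ _) _).add
    (contDiffOn_pd hK.isOpen (hK.smooth _ _) _)).sub (contDiffOn_pd hK.isOpen (hK.smooth _ _) _)

theorem IsMetricOn.pd_symm (hK : IsMetricOn K W) {y : Coord n} (hy : y ∈ W) (i a b : Fin n) :
    pd i (fun z => K z a b) y = pd i (fun z => K z b a) y :=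
  pd_congr_of_eqOn hK.isOpen hy fun _ hz => hK.symm hz a b

theorem IsMetricOn.christoffel_symm (hK : IsMetricOn K W) {y : Coord n} (hy : y ∈ W)
    (a b c : Fin n) : christoffel K y a b c = christoffel K y a c b := by
  simp only [christoffel]
  congr 1
  refine Finset.sum_congr rfl fun l _ => ?_
  rw [hK.pd_symm hy l b c]; ring

/-- Lowering the index of the Christoffel symbols. -/
theorem IsMetricOn.sum_mul_christoffel (hK : IsMetricOn K W) {y : Coord n} (hy : y ∈ W)
    (d b c : Fin n) : ∑ a, K y d a * christoffel K y a b c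
      = 1 / 2 * (pd b (fun z => K z c d) y + pd c (fun z => K z b d) y
          - pd d (fun z => K z b c) y) := by
  set S : Fin n → ℝ := fun l => pd b (fun z => K z c l) y + pd c (fun z => K z b l) y
          - pd l (fun z => K z b c) y with hS
  have h1 : (K y).mulVec ((K y)⁻¹.mulVec S) d = S d := by
    rw [Matrix.mulVec_mulVec, hK.mul_inv hy, Matrix.one_mulVec]
  have h2 : ∀ a, christoffel K y a b c = 1 / 2 * ((K y)⁻¹.mulVec S) a := fun a => rfl
  simp only [h2]
  change _ = 1 / 2 * S d
  rw [← h1]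
  simp only [Matrix.mulVec, dotProduct, Finset.mul_sum]
  exact Finset.sum_congr rfl fun a _ => Finset.sum_congr rfl fun b _ => by ring

/-- The metric is parallel. -/
theorem IsMetricOn.pd_eq (hK : IsMetricOn K W) {y : Coord n} (hy : y ∈ W) (c a b : Fin n) :
    pd c (fun z => K z a b) y = ∑ d, christoffel K y d c a * K y d b
      + ∑ d, christoffel K y d c b * K y a d := by
  have h1 := hK.sum_mul_christoffel hy b c a
  have h2 := hK.sum_mul_christoffel hy a c b
  have e1 : ∑ d, christoffel K y d c a * K y d b = ∑ d, K y b d * christoffel K y d c a :=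
    Finset.sum_congr rfl fun d _ => by rw [hK.symm hy b d]; ring
  have e2 : ∑ d, christoffel K y d c b * K y a d = ∑ d, K y a d * christoffel K y d c b :=
    Finset.sum_congr rfl fun d _ => by ring
  -- In the sum of the two lowered symbols the `∂_a` and `∂_b` terms cancel, and the two halves of
  -- `∂_c` add up.
  rw [e1, e2, h1, h2, hK.pd_symm hy c b a, hK.pd_symm hy a c b, hK.pd_symm hy b c a]
  ring

/-- The curvature operator `R(X, Y) Z`. -/
def curv (K : Coord n → Matrix (Fin n) (Fin n) ℝ) (q : Coord n) (X Y Z : Fin n → ℝ) (a : Fin n) :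
    ℝ := ∑ b, ∑ c, ∑ d, riemann K q a b c d * X c * Y d * Z b

end Metric

/-! ### Vector fields along a map -/

section Along

variable {m n : ℕ} {K : Coord n → Matrix (Fin n) (Fin n) ℝ} {W : Set (Coord n)}
  {F : Coord m → Coord n} {s : Set (Coord m)} {V V' : Coord m → Fin n → ℝ} {u : Coord m → ℝ}
  {x : Coord m} {i j : Fin m}

/-- `F` is a smooth map from the open set `s` to `W`. -/
structure IsSmoothMapOn (F : Coord m → Coord n) (s : Set (Coord m)) (W : Set (Coord n)) :
    Prop where
  isOpen : IsOpen s
  smooth : ContDiffOn ℝ ∞ F s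
  mapsTo : Set.MapsTo F s W

/-- The connection matrix of the pull-back connection. -/
def connMatrix (K : Coord n → Matrix (Fin n) (Fin n) ℝ) (F : Coord m → Coord n) (i : Fin m)
    (x : Coord m) (a c : Fin n) : ℝ :=
  ∑ b, christoffel K (F x) a b c * dMap F i x b

/-- In the form `∇_i V = ∂_i V + ω_i V` the curvature becomes `∂_i ω_j - ∂_j ω_i + [ω_i, ω_j]`. -/
theorem covAlong_eq (V : Coord m → Fin n → ℝ) (i : Fin m) (x : Coord m) (a : Fin n) :
    covAlong K F V i x a
      = pd i (fun y => V y a) x + ∑ c, connMatrix K F i x a c * V x c := by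
  simp only [covAlong, connMatrix, Finset.sum_mul]
  rw [Finset.sum_comm]

theorem covAlong_congr (h : V =ᶠ[nhds x] V') : covAlong K F V i x = covAlong K F V' i x := by
  funext a
  simp only [covAlong, h.eq_of_nhds]
  rw [pd_congr (u := fun y => V y a) (v := fun y => V' y a) (h.fun_comp (fun v => v a))]

theorem covAlong_congr_of_eqOn (hs : IsOpen s) (hx : x ∈ s) (h : Set.EqOn V V' s) :
    covAlong K F V i x = covAlong K F V' i x :=
  covAlong_congr (Filter.eventuallyEq_of_mem (hs.mem_nhds hx) h)

theorem contDiffOn_connMatrix (hK : IsMetricOn K W) (hF : IsSmoothMapOn F s W) (i : Fin m)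
    (a c : Fin n) : ContDiffOn ℝ ∞ (fun y => connMatrix K F i y a c) s :=
  ContDiffOn.sum fun b _ => ((hK.smooth_christoffel a b c).comp hF.smooth hF.mapsTo).mul
    (contDiffOn_dMap hF.isOpen hF.smooth i b)

theorem contDiffOn_covAlong (hK : IsMetricOn K W) (hF : IsSmoothMapOn F s W)
    (hV : ∀ a, ContDiffOn ℝ ∞ (fun y => V y a) s) (i : Fin m) (a : Fin n) :
    ContDiffOn ℝ ∞ (fun y => covAlong K F V i y a) s := by
  simp only [covAlong_eq]
  exact (contDiffOn_pd hF.isOpen (hV a) i).add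
    (ContDiffOn.sum fun c _ => (contDiffOn_connMatrix hK hF i a c).mul (hV c))

theorem contDiffOn_bil (hK : IsMetricOn K W) (hF : IsSmoothMapOn F s W)
    (hV : ∀ a, ContDiffOn ℝ ∞ (fun y => V y a) s) (hV' : ∀ a, ContDiffOn ℝ ∞ (fun y => V' y a) s) :
    ContDiffOn ℝ ∞ (fun y => bil (K (F y)) (V y) (V' y)) s := by
  simp only [bil_apply]
  exact ContDiffOn.sum fun a _ => ContDiffOn.sum fun b _ =>
    (((hK.smooth a b).comp hF.smooth hF.mapsTo).mul (hV a)).mul (hV' b)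

theorem covAlong_smul (hu : DifferentiableAt ℝ u x)
    (hV : ∀ a, DifferentiableAt ℝ (fun y => V y a) x) :
    covAlong K F (fun y => u y • V y) i x = pd i u x • V x + u x • covAlong K F V i x := by
  funext a
  simp only [covAlong_eq, Pi.add_apply, Pi.smul_apply, smul_eq_mul]
  rw [pd_mul hu (hV a), mul_add, Finset.mul_sum, add_assoc]
  congr 2
  exact Finset.sum_congr rfl fun c _ => by ring

theorem covAlong_add (hV : ∀ a, DifferentiableAt ℝ (fun y => V y a) x)
    (hV' : ∀ a, DifferentiableAt ℝ (fun y => V' y a) x) :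
    covAlong K F (fun y => V y + V' y) i x = covAlong K F V i x + covAlong K F V' i x := by
  funext a
  simp only [covAlong_eq, Pi.add_apply]
  rw [pd_add (hV a) (hV' a)]
  simp only [mul_add, Finset.sum_add_distrib]
  ring

/-- The pull-back connection is compatible with the metric. -/
theorem pd_bil (hK : IsMetricOn K W) (hF : IsSmoothMapOn F s W) (hx : x ∈ s)
    (hV : ∀ a, ContDiffOn ℝ ∞ (fun y => V y a) s) (hV' : ∀ a, ContDiffOn ℝ ∞ (fun y => V' y a) s) :
    pd i (fun y => bil (K (F y)) (V y) (V' y)) x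
      = bil (K (F x)) (covAlong K F V i x) (V' x) + bil (K (F x)) (V x) (covAlong K F V' i x) := by
  have dK : ∀ a b, DifferentiableAt ℝ (fun y => K (F y) a b) x := fun a b =>
    differentiableAt_of_contDiffOn ((hK.smooth a b).comp hF.smooth hF.mapsTo) hF.isOpen hx
  have dV : ∀ a, DifferentiableAt ℝ (fun y => V y a) x := fun a =>
    differentiableAt_of_contDiffOn (hV a) hF.isOpen hx
  have dV' : ∀ a, DifferentiableAt ℝ (fun y => V' y a) x := fun a =>
    differentiableAt_of_contDiffOn (hV' a) hF.isOpen hx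
  -- The chain rule applied to `∇K = 0`: the derivative of the metric along `F` is given by the
  -- connection matrix in each of its two slots.
  have hpK : ∀ a b, pd i (fun y => K (F y) a b) x
      = ∑ d, connMatrix K F i x d a * K (F x) d b + ∑ d, connMatrix K F i x d b * K (F x) a d := by
    intro a b
    rw [pd_comp (k := fun z => K z a b)
      (differentiableAt_of_contDiffOn (hK.smooth a b) hK.isOpen (hF.mapsTo hx))
      (differentiableAt_of_contDiffOn hF.smooth hF.isOpen hx)]
    simp only [hK.pd_eq (hF.mapsTo hx), connMatrix, Finset.sum_mul, add_mul,
      Finset.sum_add_distrib]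
    rw [Finset.sum_comm, Finset.sum_comm (s := Finset.univ) (t := Finset.univ)
      (f := fun c d => christoffel K (F x) d c b * K (F x) a d * dMap F i x c)]
    congr 1 <;>
    exact Finset.sum_congr rfl fun a _ => Finset.sum_congr rfl fun b _ => by ring
  simp only [bil_apply]
  rw [pd_sum fun a _ => DifferentiableAt.fun_sum fun b _ =>
    ((dK a b).fun_mul (dV a)).fun_mul (dV' b)]
  simp_rw [pd_sum fun b _ => ((dK _ b).fun_mul (dV _)).fun_mul (dV' b)]
  simp_rw [pd_mul ((dK _ _).fun_mul (dV _)) (dV' _), pd_mul (dK _ _) (dV _), hpK, covAlong_eq,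
    add_mul, mul_add, add_mul, Finset.sum_add_distrib, Finset.mul_sum, Finset.sum_mul]
  -- The two halves of the derivative of `K` are the connection terms of `∇V` and of `∇V'`.
  have e1 : ∑ a, ∑ b, ∑ d, connMatrix K F i x d a * K (F x) d b * V x a * V' x b
      = ∑ a, ∑ b, ∑ c, K (F x) a b * (connMatrix K F i x a c * V x c) * V' x b := by
    rw [Finset.sum_comm]
    rw [Finset.sum_comm (f := fun a b => ∑ c, K (F x) a b * (connMatrix K F i x a c * V x c) * V' x b)]
    refine Finset.sum_congr rfl fun b _ => ?_
    rw [Finset.sum_comm]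
    exact Finset.sum_congr rfl fun a _ => Finset.sum_congr rfl fun c _ => by ring
  have e2 : ∑ a, ∑ b, ∑ d, connMatrix K F i x d b * K (F x) a d * V x a * V' x b
      = ∑ a, ∑ b, ∑ c, K (F x) a b * V x a * (connMatrix K F i x b c * V' x c) := by
    refine Finset.sum_congr rfl fun a _ => ?_
    rw [Finset.sum_comm]
    exact Finset.sum_congr rfl fun a _ => Finset.sum_congr rfl fun c _ => by ring
  rw [e1, e2]
  ring

/-- The pull-back of the Levi-Civita connection is torsion free. -/
theorem covAlong_dMap_comm (hK : IsMetricOn K W) (hF : IsSmoothMapOn F s W) (hx : x ∈ s) :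
    covAlong K F (dMap F j) i x = covAlong K F (dMap F i) j x := by
  funext a
  simp only [covAlong]
  rw [pd_dMap_comm hF.isOpen hF.smooth hx, Finset.sum_comm]
  congr 1
  refine Finset.sum_congr rfl fun b _ => Finset.sum_congr rfl fun c _ => ?_
  rw [hK.christoffel_symm (hF.mapsTo hx)]
  ring

/-- The curvature of the pull-back connection is the pull-back of the curvature. -/
theorem covAlong_covAlong_sub (hK : IsMetricOn K W) (hF : IsSmoothMapOn F s W) (hx : x ∈ s)
    (hV : ∀ a, ContDiffOn ℝ ∞ (fun y => V y a) s) :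
    covAlong K F (covAlong K F V j) i x - covAlong K F (covAlong K F V i) j x
      = curv K (F x) (dMap F i x) (dMap F j x) (V x) := by
  funext a
  have dV : ∀ a, DifferentiableAt ℝ (fun y => V y a) x := fun a =>
    differentiableAt_of_contDiffOn (hV a) hF.isOpen hx
  have dpV : ∀ k a, DifferentiableAt ℝ (pd k (fun y => V y a)) x := fun k a =>
    differentiableAt_of_contDiffOn (contDiffOn_pd hF.isOpen (hV a) k) hF.isOpen hx
  have dC : ∀ k a c, DifferentiableAt ℝ (fun y => connMatrix K F k y a c) x := fun k a c =>
    differentiableAt_of_contDiffOn (contDiffOn_connMatrix hK hF k a c) hF.isOpen hx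
  have dF : ∀ k a, DifferentiableAt ℝ (fun y => dMap F k y a) x := fun k a =>
    differentiableAt_of_contDiffOn (contDiffOn_dMap hF.isOpen hF.smooth k a) hF.isOpen hx
  have dG : ∀ a b c, DifferentiableAt ℝ (fun y => christoffel K (F y) a b c) x := fun a b c =>
    differentiableAt_of_contDiffOn ((hK.smooth_christoffel a b c).comp hF.smooth hF.mapsTo)
      hF.isOpen hx
  have hC : ∀ k l a c, pd k (fun y => connMatrix K F l y a c) x
      = ∑ b, (∑ e, pd e (fun z => christoffel K z a b c) (F x) * dMap F k x e) * dMap F l x b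
        + ∑ b, christoffel K (F x) a b c * pd k (fun y => dMap F l y b) x := by
    intro k l a c
    simp only [connMatrix]
    rw [pd_sum_mul (fun b _ => dG a b c) (fun b _ => dF l b), Finset.sum_add_distrib]
    congr 1
    refine Finset.sum_congr rfl fun b _ => ?_
    rw [pd_comp (k := fun z => christoffel K z a b c)
      (differentiableAt_of_contDiffOn (hK.smooth_christoffel a b c) hK.isOpen (hF.mapsTo hx))
      (differentiableAt_of_contDiffOn hF.smooth hF.isOpen hx)]
  have hD : ∀ k l, covAlong K F (covAlong K F V l) k x a
      = pd k (pd l (fun y => V y a)) x + ∑ c, pd k (fun y => connMatrix K F l y a c) x * V x c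
        + ∑ c, (connMatrix K F l x a c * pd k (fun y => V y c) x
          + connMatrix K F k x a c * pd l (fun y => V y c) x)
        + ∑ d, ∑ c, connMatrix K F k x a c * connMatrix K F l x c d * V x d := by
    intro k l
    rw [covAlong_eq]
    simp only [covAlong_eq V]
    rw [pd_add (dpV l a) (DifferentiableAt.fun_sum fun c _ => (dC l a c).fun_mul (dV c)),
      pd_sum_mul (fun c _ => dC l a c) (fun c _ => dV c)]
    simp only [mul_add, Finset.sum_add_distrib, Finset.mul_sum]
    rw [Finset.sum_comm (f := fun c d => connMatrix K F k x a c * (connMatrix K F l x c d * V x d))]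
    simp only [mul_assoc]
    ring
  rw [Pi.sub_apply, hD, hD, pd_comm hF.isOpen (hV a) hx]
  have e1 : ∑ c, (connMatrix K F j x a c * pd i (fun y => V y c) x
          + connMatrix K F i x a c * pd j (fun y => V y c) x)
      = ∑ c, (connMatrix K F i x a c * pd j (fun y => V y c) x
          + connMatrix K F j x a c * pd i (fun y => V y c) x) :=
    Finset.sum_congr rfl fun c _ => add_comm _ _
  rw [e1]
  -- Cartan's structure equation for the pull-back connection; the second derivatives of `F` cancel
  -- by symmetry.
  have e2 : ∀ k, (pd i (fun y => connMatrix K F j y a k) x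
        + ∑ c, connMatrix K F i x a c * connMatrix K F j x c k)
      - (pd j (fun y => connMatrix K F i y a k) x
        + ∑ c, connMatrix K F j x a c * connMatrix K F i x c k)
      = ∑ c, ∑ d, riemann K (F x) a k c d * dMap F i x c * dMap F j x d := by
    intro k
    rw [hC, hC]
    simp only [pd_dMap_comm hF.isOpen hF.smooth hx (i := i) (j := j)]
    have r1 : ∑ c, connMatrix K F i x a c * connMatrix K F j x c k
        = ∑ c, ∑ d, (∑ s, christoffel K (F x) a c s * christoffel K (F x) s d k)
          * dMap F i x c * dMap F j x d := by
      simp only [connMatrix, Finset.sum_mul_sum]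
      simp only [Finset.sum_mul]
      rw [Finset.sum_comm]
      refine Finset.sum_congr rfl fun c _ => ?_
      rw [Finset.sum_comm]
      exact Finset.sum_congr rfl fun d _ => Finset.sum_congr rfl fun s _ => by ring
    have r2 : ∑ c, connMatrix K F j x a c * connMatrix K F i x c k
        = ∑ c, ∑ d, (∑ s, christoffel K (F x) a d s * christoffel K (F x) s c k)
          * dMap F i x c * dMap F j x d := by
      simp only [connMatrix, Finset.sum_mul_sum]
      simp only [Finset.sum_mul]
      rw [Finset.sum_comm, Finset.sum_comm (f := fun c d => ∑ s, christoffel K (F x) a d s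
        * christoffel K (F x) s c k * dMap F i x c * dMap F j x d)]
      refine Finset.sum_congr rfl fun c _ => ?_
      rw [Finset.sum_comm]
      exact Finset.sum_congr rfl fun d _ => Finset.sum_congr rfl fun s _ => by ring
    have r3 : ∑ b, (∑ e, pd e (fun z => christoffel K z a b k) (F x) * dMap F i x e) * dMap F j x b
        = ∑ c, ∑ d, pd c (fun z => christoffel K z a d k) (F x) * dMap F i x c * dMap F j x d := by
      simp only [Finset.sum_mul]
      rw [Finset.sum_comm]
    have r4 : ∑ b, (∑ e, pd e (fun z => christoffel K z a b k) (F x) * dMap F j x e) * dMap F i x b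
        = ∑ c, ∑ d, pd d (fun z => christoffel K z a c k) (F x) * dMap F i x c * dMap F j x d := by
      simp only [Finset.sum_mul]
      exact Finset.sum_congr rfl fun d _ => Finset.sum_congr rfl fun s _ => by ring
    rw [r1, r2, r3, r4]
    simp only [riemann, Finset.sum_sub_distrib, add_mul, sub_mul, Finset.sum_add_distrib]
    ring
  have e3 : curv K (F x) (dMap F i x) (dMap F j x) (V x) a
      = ∑ k, (∑ c, ∑ d, riemann K (F x) a k c d * dMap F i x c * dMap F j x d) * V x k := by
    simp only [curv, Finset.sum_mul]
  rw [e3]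
  simp only [← e2, sub_mul, add_mul, Finset.sum_sub_distrib, Finset.sum_add_distrib,
    Finset.sum_mul]
  ring

end Along

/-! ### Symmetries of the curvature -/

section Curvature

variable {n : ℕ} {K : Coord n → Matrix (Fin n) (Fin n) ℝ} {W : Set (Coord n)} {q : Coord n}

/-- Reduces curvature identities to coordinate vectors in the first two slots, where the curvature
is a commutator of covariant derivatives. -/
theorem curv_eq_sum (X Y Z : Fin n → ℝ) :
    curv K q X Y Z = ∑ c, ∑ d, (X c * Y d) • curv K q (Pi.single c 1) (Pi.single d 1) Z := by
  funext a
  have h : ∀ c d, curv K q (Pi.single c 1) (Pi.single d 1) Z a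
      = ∑ b, riemann K q a b c d * Z b := by
    intro c d
    simp [curv, Pi.single_apply]
  simp only [Finset.sum_apply, Pi.smul_apply, smul_eq_mul, h, Finset.mul_sum]
  simp only [curv]
  rw [Finset.sum_comm]
  refine Finset.sum_congr rfl fun c _ => ?_
  rw [Finset.sum_comm]
  exact Finset.sum_congr rfl fun d _ => Finset.sum_congr rfl fun b _ => by ring

theorem curv_smul_middle (u : ℝ) (X Y Z : Fin n → ℝ) :
    curv K q X (u • Y) Z = u • curv K q X Y Z := by
  funext a
  simp only [curv, Pi.smul_apply, smul_eq_mul, Finset.mul_sum]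
  exact Finset.sum_congr rfl fun b _ => Finset.sum_congr rfl fun c _ =>
    Finset.sum_congr rfl fun d _ => by ring

theorem riemann_antisymm (a b c d : Fin n) : riemann K q a b c d = -riemann K q a b d c := by
  simp only [riemann, Finset.sum_sub_distrib]
  ring

theorem curv_antisymm (X Y Z : Fin n → ℝ) : curv K q X Y Z = -curv K q Y X Z := by
  funext a
  simp only [curv, Pi.neg_apply, ← Finset.sum_neg_distrib]
  refine Finset.sum_congr rfl fun b _ => ?_
  rw [Finset.sum_comm]
  refine Finset.sum_congr rfl fun c _ => Finset.sum_congr rfl fun d _ => ?_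
  rw [riemann_antisymm]
  ring

theorem curv_self (X Z : Fin n → ℝ) : curv K q X X Z = 0 := by
  have := curv_antisymm (K := K) (q := q) X X Z
  exact self_eq_neg.1 this

/-- The connection is torsion free: once the lower indices of the Christoffel symbols are exchanged,
all terms cancel in pairs. -/
theorem IsMetricOn.riemann_cyclic (hK : IsMetricOn K W) (hq : q ∈ W) (a b c d : Fin n) :
    riemann K q a b c d + riemann K q a c d b + riemann K q a d b c = 0 := by
  have h : ∀ i k l, pd i (fun y => christoffel K y a k l) q
      = pd i (fun y => christoffel K y a l k) q := fun i k l =>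
    pd_congr_of_eqOn hK.isOpen hq fun y hy => hK.christoffel_symm hy a k l
  simp only [riemann, Finset.sum_sub_distrib]
  rw [h c d b, h d c b, h b c d]
  have h2 : ∀ k l m, ∑ s, christoffel K q a k s * christoffel K q s l m
      = ∑ s, christoffel K q a k s * christoffel K q s m l := fun k l m =>
    Finset.sum_congr rfl fun s _ => by rw [hK.christoffel_symm hq s l m]
  rw [h2 c d b, h2 d c b, h2 b c d]
  ring

/-- The first Bianchi identity. -/
theorem IsMetricOn.curv_cyclic (hK : IsMetricOn K W) (hq : q ∈ W) (X Y Z : Fin n → ℝ) :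
    curv K q X Y Z + curv K q Y Z X + curv K q Z X Y = 0 := by
  funext a
  have h1 : curv K q Y Z X a
      = ∑ b, ∑ c, ∑ d, riemann K q a c d b * X c * Y d * Z b := by
    simp only [curv]
    rw [Finset.sum_comm_cycle]
    exact Finset.sum_congr rfl fun b _ => Finset.sum_congr rfl fun c _ =>
      Finset.sum_congr rfl fun d _ => by ring
  have h2 : curv K q Z X Y a
      = ∑ b, ∑ c, ∑ d, riemann K q a d b c * X c * Y d * Z b := by
    simp only [curv]
    rw [← Finset.sum_comm_cycle]
    exact Finset.sum_congr rfl fun b _ => Finset.sum_congr rfl fun c _ =>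
      Finset.sum_congr rfl fun d _ => by ring
  simp only [Pi.add_apply, Pi.zero_apply, h1, h2]
  simp only [curv, ← Finset.sum_add_distrib, ← add_mul, hK.riemann_cyclic hq]
  simp

/-- Vector fields on the target are fields along the identity, so the pull-back calculus also covers
them. -/
theorem isSmoothMapOn_id (hK : IsMetricOn K W) : IsSmoothMapOn (fun y : Coord n => y) W W :=
  ⟨hK.isOpen, contDiffOn_id, fun _ hy => hy⟩

theorem dMap_id (i : Fin n) (q : Coord n) : dMap (fun y : Coord n => y) i q = Pi.single i 1 := by
  funext a
  have := ((EuclideanSpace.proj (𝕜 := ℝ) a).hasFDerivAt (x := q)).fderiv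
  simp only [dMap, pd]
  change fderiv ℝ (EuclideanSpace.proj (𝕜 := ℝ) a) q _ = _
  rw [this]
  simp [Pi.single_apply]

/-- The second derivatives of the inner product of two vector fields along a map. -/
theorem pd_pd_bil {m : ℕ} {F : Coord m → Coord n} {s : Set (Coord m)} {x : Coord m}
    {V V' : Coord m → Fin n → ℝ} {i j : Fin m} (hK : IsMetricOn K W) (hF : IsSmoothMapOn F s W)
    (hx : x ∈ s) (hV : ∀ a, ContDiffOn ℝ ∞ (fun y => V y a) s)
    (hV' : ∀ a, ContDiffOn ℝ ∞ (fun y => V' y a) s) :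
    pd i (pd j (fun y => bil (K (F y)) (V y) (V' y))) x
      = bil (K (F x)) (covAlong K F (covAlong K F V j) i x) (V' x)
        + bil (K (F x)) (covAlong K F V j x) (covAlong K F V' i x)
        + (bil (K (F x)) (covAlong K F V i x) (covAlong K F V' j x)
        + bil (K (F x)) (V x) (covAlong K F (covAlong K F V' j) i x)) := by
  have hDV := contDiffOn_covAlong hK hF hV j
  have hDV' := contDiffOn_covAlong hK hF hV' j
  rw [pd_congr_of_eqOn hF.isOpen hx fun y hy => pd_bil hK hF hy hV hV',
    pd_add (differentiableAt_of_contDiffOn (contDiffOn_bil hK hF hDV hV') hF.isOpen hx)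
      (differentiableAt_of_contDiffOn (contDiffOn_bil hK hF hV hDV') hF.isOpen hx),
    pd_bil hK hF hx hDV hV', pd_bil hK hF hx hV hDV']

/-- Extend `Z` and `V` with constant components. The second derivatives of `⟨Z, V⟩` commute;
expanding them by metric compatibility, the mixed terms cancel and the commutators `⟨R Z, V⟩ + ⟨Z, R
V⟩` remain. -/
theorem IsMetricOn.bil_curv_antisymm (hK : IsMetricOn K W) (hq : q ∈ W) (X Y Z V : Fin n → ℝ) :
    bil (K q) (curv K q X Y Z) V = -bil (K q) (curv K q X Y V) Z := by
  have hF := isSmoothMapOn_id hK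
  have hc : ∀ (T : Fin n → ℝ) (a : Fin n), ContDiffOn ℝ ∞ (fun _ : Coord n => T a) W :=
    fun T a => contDiffOn_const
  have key : ∀ i j, bil (K q) (curv K q (Pi.single i 1) (Pi.single j 1) Z) V
      = -bil (K q) (curv K q (Pi.single i 1) (Pi.single j 1) V) Z := by
    intro i j
    have hZ := covAlong_covAlong_sub (i := i) (j := j) hK hF hq (V := fun _ => Z) (hc Z)
    have hV := covAlong_covAlong_sub (i := i) (j := j) hK hF hq (V := fun _ => V) (hc V)
    have h1 := pd_pd_bil (i := i) (j := j) hK hF hq (V := fun _ => Z) (V' := fun _ => V)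
      (hc Z) (hc V)
    have h2 := pd_pd_bil (i := j) (j := i) hK hF hq (V := fun _ => Z) (V' := fun _ => V)
      (hc Z) (hc V)
    have h3 := pd_comm (i := i) (j := j) hF.isOpen
      (contDiffOn_bil hK hF (V := fun _ => Z) (V' := fun _ => V) (hc Z) (hc V)) hq
    simp only [dMap_id] at hZ hV
    rw [← hZ, ← hV, bil_comm (hK.symm hq) _ Z, map_sub, map_sub, LinearMap.sub_apply]
    linarith
  rw [curv_eq_sum X Y Z, curv_eq_sum X Y V]
  simp only [map_sum, map_smul, LinearMap.sum_apply, LinearMap.smul_apply, smul_eq_mul, key,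
    ← Finset.sum_neg_distrib, mul_neg]

/-- The usual linear combination of four Bianchi identities with the two antisymmetries. -/
theorem IsMetricOn.bil_curv_pair (hK : IsMetricOn K W) (hq : q ∈ W) (X Y Z V : Fin n → ℝ) :
    bil (K q) (curv K q X Y Z) V = bil (K q) (curv K q Z V X) Y := by
  have cyc : ∀ X Y Z V : Fin n → ℝ, bil (K q) (curv K q X Y Z) V + bil (K q) (curv K q Y Z X) V
      + bil (K q) (curv K q Z X Y) V = 0 := by
    intro X Y Z V
    rw [← LinearMap.add_apply, ← LinearMap.add_apply, ← map_add, ← map_add, hK.curv_cyclic hq]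
    simp
  have a1 : ∀ X Y Z V : Fin n → ℝ, bil (K q) (curv K q X Y Z) V
      = -bil (K q) (curv K q Y X Z) V := by
    intro X Y Z V
    rw [curv_antisymm]
    simp
  have a2 := hK.bil_curv_antisymm hq
  linarith [cyc X Y Z V, cyc Y Z V X, cyc Z V X Y, cyc V X Y Z, a2 Y Z X V, a2 Z V X Y,
    a1 V Y Z X, a1 X Z V Y, a2 Z X V Y, a2 V X Y Z, a2 X Y Z V, a2 Y V X Z]

/-- The Ricci curvature as a bilinear form. -/
def ric (K : Coord n → Matrix (Fin n) (Fin n) ℝ) (q : Coord n) (X Y : Fin n → ℝ) : ℝ :=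
  ∑ a, ∑ b, ricci K q a b * X a * Y b

theorem ric_eq_trace (X Y : Fin n → ℝ) :
    ric K q X Y = ∑ i, curv K q (Pi.single i 1) X Y i := by
  simp only [ric, ricci, curv, Pi.single_apply, Finset.sum_mul]
  simp only [mul_ite, mul_one, mul_zero, ite_mul, zero_mul, Finset.sum_ite_irrel,
    Finset.sum_const_zero, Finset.sum_ite_eq', Finset.mem_univ, if_true]
  rw [Finset.sum_comm_cycle]
  refine Finset.sum_congr rfl fun i _ => ?_
  rw [Finset.sum_comm]

end Curvature

/-! ### The Jacobi-type operator underlying the bitension field -/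

section Jacobi

variable {m n : ℕ} {G : Coord m → Matrix (Fin m) (Fin m) ℝ}
  {K : Coord n → Matrix (Fin n) (Fin n) ℝ} {W : Set (Coord n)}
  {F : Coord m → Coord n} {s : Set (Coord m)} {V V' : Coord m → Fin n → ℝ} {u : Coord m → ℝ}
  {x : Coord m}

/-- The trace `Trace_g R^N(dF, Y) dF`. -/
def curvTrace (G : Coord m → Matrix (Fin m) (Fin m) ℝ) (K : Coord n → Matrix (Fin n) (Fin n) ℝ)
    (F : Coord m → Coord n) (x : Coord m) (Y : Fin n → ℝ) : Fin n → ℝ :=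
  ∑ i, ∑ j, (G x)⁻¹ i j • curv K (F x) (dMap F i x) Y (dMap F j x)

/-- The operator `V ↦ Trace_g (∇^F ∇^F - ∇^F_{∇^M}) V - Trace_g R^N(dF, V) dF`. -/
def jacobiOp (G : Coord m → Matrix (Fin m) (Fin m) ℝ) (K : Coord n → Matrix (Fin n) (Fin n) ℝ)
    (F : Coord m → Coord n) (V : Coord m → Fin n → ℝ) (x : Coord m) : Fin n → ℝ :=
  roughLaplacian G K F V x - curvTrace G K F x (V x)

/-- Separates the operator from the field it acts on, since the two respond separately to a change
of the source metric. -/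
theorem bitension_eq_jacobiOp : bitension G K F x = jacobiOp G K F (tension G K F) x := by
  funext a
  simp only [bitension, jacobiOp, Pi.sub_apply, curvTrace, Finset.sum_apply, Pi.smul_apply, curv,
    smul_eq_mul]

/-- The vector form `g^{ij} (A_ij - Γ^k_ij B_k)`, shared with the tension field, is the one to which
the conformal comparison applies. -/
theorem roughLaplacian_eq (V : Coord m → Fin n → ℝ) :
    roughLaplacian G K F V x = ∑ i, ∑ j, (G x)⁻¹ i j • (covAlong K F (covAlong K F V j) i x
      - ∑ k, christoffel G x k i j • covAlong K F V k x) := by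
  funext a
  simp [roughLaplacian]

theorem tension_eq :
    tension G K F x = ∑ i, ∑ j, (G x)⁻¹ i j • (covAlong K F (dMap F j) i x
      - ∑ k, christoffel G x k i j • dMap F k x) := by
  funext a
  simp [tension]

theorem roughLaplacian_congr (h : V =ᶠ[nhds x] V') :
    roughLaplacian G K F V x = roughLaplacian G K F V' x := by
  have h2 : ∀ j, covAlong K F V j =ᶠ[nhds x] covAlong K F V' j := fun j =>
    h.eventuallyEq_nhds.mono fun y hy => covAlong_congr hy
  simp only [roughLaplacian_eq, covAlong_congr h, covAlong_congr (h2 _)]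

/-- Locality is needed because the formulas for the tension field hold only on the domain of the
charts. -/
theorem jacobiOp_congr (h : V =ᶠ[nhds x] V') : jacobiOp G K F V x = jacobiOp G K F V' x := by
  simp only [jacobiOp, roughLaplacian_congr h, h.eq_of_nhds]

theorem curvTrace_smul (c : ℝ) (Y : Fin n → ℝ) :
    curvTrace G K F x (c • Y) = c • curvTrace G K F x Y := by
  simp only [curvTrace, curv_smul_middle, Finset.smul_sum]
  exact Finset.sum_congr rfl fun b _ => Finset.sum_congr rfl fun c _ => smul_comm _ _ _

theorem covAlong_covAlong_smul (hK : IsMetricOn K W) (hF : IsSmoothMapOn F s W)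
    (hx : x ∈ s) (hu : ContDiffOn ℝ ∞ u s) (hV : ∀ a, ContDiffOn ℝ ∞ (fun y => V y a) s)
    (i j : Fin m) :
    covAlong K F (covAlong K F (fun y => u y • V y) j) i x
      = pd i (pd j u) x • V x + pd j u x • covAlong K F V i x
        + (pd i u x • covAlong K F V j x + u x • covAlong K F (covAlong K F V j) i x) := by
  have d : ∀ {w : Coord m → ℝ}, ContDiffOn ℝ ∞ w s → ∀ {y}, y ∈ s → DifferentiableAt ℝ w y :=
    fun hw _ hy => differentiableAt_of_contDiffOn hw hF.isOpen hy
  have hpu := contDiffOn_pd hF.isOpen hu j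
  have hDV := contDiffOn_covAlong hK hF hV j
  rw [covAlong_congr_of_eqOn hF.isOpen hx
    (fun y hy => covAlong_smul (d hu hy) fun a => d (hV a) hy),
    covAlong_add (V := fun y => pd j u y • V y) (V' := fun y => u y • covAlong K F V j y)
      (fun a => (d hpu hx).fun_mul (d (hV a) hx))
      (fun a => (d hu hx).fun_mul (d (hDV a) hx)),
    covAlong_smul (d hpu hx) (fun a => d (hV a) hx), covAlong_smul (d hu hx) fun a => d (hDV a) hx]

theorem roughLaplacian_smul (hG : IsMetricOn G s) (hK : IsMetricOn K W) (hF : IsSmoothMapOn F s W)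
    (hx : x ∈ s) (hu : ContDiffOn ℝ ∞ u s) (hV : ∀ a, ContDiffOn ℝ ∞ (fun y => V y a) s) :
    roughLaplacian G K F (fun y => u y • V y) x
      = u x • roughLaplacian G K F V x + laplacian G u x • V x
        + (2 : ℝ) • ∑ k, grad G u x k • covAlong K F V k x := by
  have d : ∀ {w : Coord m → ℝ}, ContDiffOn ℝ ∞ w s → DifferentiableAt ℝ w x :=
    fun hw => differentiableAt_of_contDiffOn hw hF.isOpen hx
  simp only [roughLaplacian_eq, covAlong_covAlong_smul hK hF hx hu hV,
    covAlong_smul (d hu) fun a => d (hV a)]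
  have e1 : ∑ k, grad G u x k • covAlong K F V k x
      = ∑ i, ∑ j, (G x)⁻¹ i j • pd j u x • covAlong K F V i x := by
    simp only [grad, Finset.sum_smul, smul_smul]
  have e2 : ∑ k, grad G u x k • covAlong K F V k x
      = ∑ i, ∑ j, (G x)⁻¹ i j • pd i u x • covAlong K F V j x := by
    rw [e1, Finset.sum_comm]
    exact Finset.sum_congr rfl fun b _ => Finset.sum_congr rfl fun c _ => by rw [hG.inv_symm hx]
  -- The two cross terms of the Leibniz rule agree only after exchanging `i` and `j`, so the
  -- gradient term is split and written once in each order.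
  rw [two_smul]
  nth_rw 1 [e1]
  rw [e2]
  simp only [laplacian, Finset.smul_sum, Finset.sum_smul, ← Finset.sum_add_distrib]
  refine Finset.sum_congr rfl fun i _ => Finset.sum_congr rfl fun j _ => ?_
  have e3 : ∑ k, christoffel G x k i j • (pd k u x • V x + u x • covAlong K F V k x)
      = (∑ k, christoffel G x k i j * pd k u x) • V x
        + u x • ∑ k, christoffel G x k i j • covAlong K F V k x := by
    simp only [smul_add, Finset.sum_add_distrib, Finset.sum_smul, Finset.smul_sum, smul_smul,
      mul_comm (u x)]
  rw [e3]
  module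

/-- The terms `(Δf) τ` and `2 ∇_{grad f} τ` are those produced by the Leibniz rule for the rough
Laplacian of `f τ`; the curvature term is linear over functions. -/
theorem fBitension_eq_jacobiOp {f : Coord m → ℝ} (hG : IsMetricOn G s) (hK : IsMetricOn K W)
    (hF : IsSmoothMapOn F s W) (hx : x ∈ s) (hf : ContDiffOn ℝ ∞ f s)
    (hτ : ∀ a, ContDiffOn ℝ ∞ (fun y => tension G K F y a) s) :
    fBitension G K f F x = jacobiOp G K F (fun y => f y • tension G K F y) x := by
  rw [jacobiOp, roughLaplacian_smul hG hK hF hx hf hτ, curvTrace_smul]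
  funext a
  simp only [fBitension, bitension_eq_jacobiOp, jacobiOp, Pi.sub_apply, Pi.add_apply,
    Pi.smul_apply, smul_eq_mul, Finset.sum_apply]
  ring

theorem contDiffOn_tension (hG : IsMetricOn G s) (hK : IsMetricOn K W)
    (hF : IsSmoothMapOn F s W) (a : Fin n) : ContDiffOn ℝ ∞ (fun y => tension G K F y a) s := by
  refine ContDiffOn.sum fun i _ => ContDiffOn.sum fun j _ => (hG.smooth_inv i j).mul ?_
  refine (contDiffOn_covAlong hK hF (contDiffOn_dMap hF.isOpen hF.smooth j) i a).sub ?_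
  exact ContDiffOn.sum fun k _ => (hG.smooth_christoffel k i j).mul
    (contDiffOn_dMap hF.isOpen hF.smooth k a)

end Jacobi

/-! ### Conformal changes of the metric on a surface -/

section Conformal

variable {n : ℕ} {G G' : Coord 2 → Matrix (Fin 2) (Fin 2) ℝ}
  {K : Coord n → Matrix (Fin n) (Fin n) ℝ} {W : Set (Coord n)}
  {F : Coord 2 → Coord n} {s : Set (Coord 2)} {V : Coord 2 → Fin n → ℝ} {f : Coord 2 → ℝ}
  {x : Coord 2}

theorem inv_conformal {ι : Type*} [Fintype ι] [DecidableEq ι] {A B : Matrix ι ι ℝ} {c : ℝ}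
    (hc : c ≠ 0) (hA : IsUnit A.det) (h : B = c • A) : A⁻¹ = c • B⁻¹ := by
  rw [h]
  have := Matrix.inv_smul' A (Units.mk0 c hc) hA
  rw [show c • A = (Units.mk0 c hc) • A from rfl, this]
  ext i j
  simp [Units.smul_def, hc]

/-- The contracted Christoffel symbols of conformal metrics on a surface are proportional. -/
theorem sum_inv_mul_christoffel_conformal (hG : IsMetricOn G s) (hx : x ∈ s)
    (hf : ContDiffOn ℝ ∞ f s) (hfpos : ∀ y ∈ s, 0 < f y) (hG' : ∀ y ∈ s, G' y = f y • G y)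
    (k : Fin 2) :
    ∑ i, ∑ j, (G x)⁻¹ i j * christoffel G x k i j
      = f x * ∑ i, ∑ j, (G' x)⁻¹ i j * christoffel G' x k i j := by
  have hf0 := (hfpos x hx).ne'
  have hinv := inv_conformal hf0 (hG.isUnit_det hx) (hG' x hx)
  have hinv' : (G' x)⁻¹ = (f x)⁻¹ • (G x)⁻¹ := by
    rw [hinv, smul_smul, inv_mul_cancel₀ hf0, one_smul]
  have hpd : ∀ i a b, pd i (fun y => G' y a b) x
      = pd i f x * G x a b + f x * pd i (fun y => G y a b) x := by
    intro i a b
    rw [← pd_mul (differentiableAt_of_contDiffOn hf hG.isOpen hx)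
      (differentiableAt_of_contDiffOn (hG.smooth a b) hG.isOpen hx)]
    exact pd_congr_of_eqOn hG.isOpen hx fun y hy => by simp [hG' y hy]
  have hone : ∀ a b, ∑ c, (G x)⁻¹ a c * G x c b = (1 : Matrix (Fin 2) (Fin 2) ℝ) a b := by
    intro a b
    rw [← hG.inv_mul hx, Matrix.mul_apply]
  have h00 := hone 0 0
  have h01 := hone 0 1
  have h10 := hone 1 0
  have h11 := hone 1 1
  have hs := hG.symm hx 0 1
  have hsi := hG.inv_symm hx 0 1
  -- With `c = df` and `d` a row of the inverse metric, this is the trace of the change of the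
  -- Christoffel symbols, up to a factor. It equals `(2 - m) ∑ c_l d_l`, which is zero as `m = 2`.
  have key : ∀ c d : Fin 2 → ℝ, ∑ i, ∑ j, (G x)⁻¹ i j * ∑ l, d l *
      (c i * G x j l + c j * G x i l - c l * G x i j) = 0 := by
    intro c d
    simp only [Fin.sum_univ_two, Matrix.one_apply_eq, ne_eq, zero_ne_one, one_ne_zero,
      not_false_eq_true, Matrix.one_apply_ne] at h00 h01 h10 h11 ⊢
    rw [← hsi, ← hs] at *
    linear_combination (d 0 * c 0 - d 1 * c 1) * (h00 - h11) + 2 * d 1 * c 0 * h01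
      + 2 * d 0 * c 1 * h10
  simp only [christoffel, hpd, hinv', Matrix.smul_apply, smul_eq_mul]
  have := key (fun i => pd i f x) (fun l => (G x)⁻¹ k l)
  simp only [Fin.sum_univ_two] at this ⊢
  field_simp
  linear_combination (-1) * this

/-- The arrays `A` and `B` do not involve the source metric, so one statement serves the tension
field and the rough Laplacian. -/
theorem sum_inv_smul_sub_conformal {E : Type*} [AddCommGroup E] [Module ℝ E]
    (hG : IsMetricOn G s) (hx : x ∈ s)
    (hf : ContDiffOn ℝ ∞ f s) (hfpos : ∀ y ∈ s, 0 < f y) (hG' : ∀ y ∈ s, G' y = f y • G y)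
    (A : Fin 2 → Fin 2 → E) (B : Fin 2 → E) :
    ∑ i, ∑ j, (G x)⁻¹ i j • (A i j - ∑ k, christoffel G x k i j • B k)
      = f x • ∑ i, ∑ j, (G' x)⁻¹ i j • (A i j - ∑ k, christoffel G' x k i j • B k) := by
  have split : ∀ (P : Matrix (Fin 2) (Fin 2) ℝ) (C : Fin 2 → Fin 2 → Fin 2 → ℝ),
      ∑ i, ∑ j, P i j • (A i j - ∑ k, C k i j • B k)
        = ∑ i, ∑ j, P i j • A i j - ∑ k, (∑ i, ∑ j, P i j * C k i j) • B k := by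
    intro P C
    simp only [Fin.sum_univ_two]
    module
  rw [split _ (christoffel G x), split _ (christoffel G' x)]
  simp only [sum_inv_mul_christoffel_conformal hG hx hf hfpos hG']
  rw [inv_conformal (hfpos x hx).ne' (hG.isUnit_det hx) (hG' x hx)]
  simp only [Matrix.smul_apply, smul_sub, Finset.smul_sum, smul_assoc, mul_smul]

/-- The bitension field of a map with respect to conformal metrics on a surface. -/
theorem bitension_conformal (hG : IsMetricOn G s) (hG'm : IsMetricOn G' s) (hK : IsMetricOn K W)
    (hF : IsSmoothMapOn F s W) (hx : x ∈ s) (hf : ContDiffOn ℝ ∞ f s)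
    (hfpos : ∀ y ∈ s, 0 < f y) (hG' : ∀ y ∈ s, G' y = f y • G y) :
    bitension G K F x = f x • fBitension G' K f F x := by
  -- Needed on all of `s`, because the operator differentiates the tension field.
  have hτ : Set.EqOn (tension G K F) (fun y => f y • tension G' K F y) s := fun y hy => by
    simp only [tension_eq]
    exact sum_inv_smul_sub_conformal hG hy hf hfpos hG' _ _
  rw [bitension_eq_jacobiOp, jacobiOp_congr (Filter.eventuallyEq_of_mem (hF.isOpen.mem_nhds hx) hτ),
    fBitension_eq_jacobiOp hG'm hK hF hx hf (contDiffOn_tension hG'm hK hF), jacobiOp, jacobiOp,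
    smul_sub]
  -- Both sides now apply the operator to the same field `f τ`, with respect to the two metrics;
  -- each trace scales by `f`.
  congr 1
  · simp only [roughLaplacian_eq]
    exact sum_inv_smul_sub_conformal hG hx hf hfpos hG' _ _
  · simp only [curvTrace]
    rw [inv_conformal (hfpos x hx).ne' (hG.isUnit_det hx) (hG' x hx)]
    simp only [Matrix.smul_apply, Finset.smul_sum, smul_assoc]

end Conformal

/-! ### Immersed surfaces with a unit normal field -/

section Surface

/-- `G` is the metric induced by `K` on the surface `F`, and `ν` is a smooth unit normal field. -/
structure IsSurfaceOn (G : Coord 2 → Matrix (Fin 2) (Fin 2) ℝ)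
    (K : Coord 3 → Matrix (Fin 3) (Fin 3) ℝ) (F : Coord 2 → Coord 3)
    (ν : Coord 2 → Fin 3 → ℝ) (s : Set (Coord 2)) (W : Set (Coord 3)) : Prop where
  metric : IsMetricOn K W
  map : IsSmoothMapOn F s W
  source : IsMetricOn G s
  induced : ∀ x ∈ s, ∀ i j, G x i j = bil (K (F x)) (dMap F i x) (dMap F j x)
  smooth : ∀ a, ContDiffOn ℝ ∞ (fun y => ν y a) s
  unit : ∀ x ∈ s, bil (K (F x)) (ν x) (ν x) = 1
  normal : ∀ x ∈ s, ∀ i, bil (K (F x)) (ν x) (dMap F i x) = 0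

/-- The second fundamental form. -/
def secondForm {m n : ℕ} (K : Coord n → Matrix (Fin n) (Fin n) ℝ) (F : Coord m → Coord n)
    (ν : Coord m → Fin n → ℝ) (i j : Fin m) (x : Coord m) : ℝ :=
  -bil (K (F x)) (covAlong K F ν i x) (dMap F j x)

variable {G : Coord 2 → Matrix (Fin 2) (Fin 2) ℝ} {K : Coord 3 → Matrix (Fin 3) (Fin 3) ℝ}
  {F : Coord 2 → Coord 3} {ν : Coord 2 → Fin 3 → ℝ} {s : Set (Coord 2)} {W : Set (Coord 3)}
  {x : Coord 2} {u : Coord 2 → ℝ}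

namespace IsSurfaceOn

theorem smooth_dMap (h : IsSurfaceOn G K F ν s W) (i : Fin 2) (a : Fin 3) :
    ContDiffOn ℝ ∞ (fun y => dMap F i y a) s := contDiffOn_dMap h.map.isOpen h.map.smooth i a

theorem bil_comm (h : IsSurfaceOn G K F ν s W) (hx : x ∈ s) (v w : Fin 3 → ℝ) :
    bil (K (F x)) v w = bil (K (F x)) w v :=
  BiharmonicSurface.bil_comm (h.metric.symm (h.map.mapsTo hx)) v w

theorem normal' (h : IsSurfaceOn G K F ν s W) (hx : x ∈ s) (i : Fin 2) :
    bil (K (F x)) (dMap F i x) (ν x) = 0 := by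
  rw [h.bil_comm hx, h.normal x hx]

theorem sum_inv_mul (h : IsSurfaceOn G K F ν s W) (hx : x ∈ s) (i j : Fin 2) :
    ∑ k, (G x)⁻¹ i k * G x k j = (1 : Matrix (Fin 2) (Fin 2) ℝ) i j := by
  rw [← h.source.inv_mul hx, Matrix.mul_apply]

/-- A vector orthogonal to the tangent plane and to the normal vanishes. -/
theorem eq_zero (h : IsSurfaceOn G K F ν s W) (hx : x ∈ s) {Z : Fin 3 → ℝ}
    (hT : ∀ j, bil (K (F x)) Z (dMap F j x) = 0) (hN : bil (K (F x)) Z (ν x) = 0) : Z = 0 := by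
  -- The rows of `Q` are the frame. Its Gram matrix `Q K Qᵀ` has determinant `det G > 0`, so `Q` is
  -- invertible and `Q K Z = 0` forces `Z = 0`.
  set Q : Matrix (Fin 3) (Fin 3) ℝ := Matrix.of ![dMap F 0 x, dMap F 1 x, ν x] with hQ
  have hgram : Q * K (F x) * Q.transpose
      = !![G x 0 0, G x 0 1, 0; G x 1 0, G x 1 1, 0; 0, 0, 1] := by
    have : ∀ i j, (Q * K (F x) * Q.transpose) i j = bil (K (F x)) (Q i) (Q j) := by
      intro i j
      rw [bil_mulVec, Matrix.mul_apply]
      simp only [Matrix.mul_apply, Matrix.transpose_apply, dotProduct, Matrix.mulVec,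
        Finset.sum_mul, Finset.mul_sum]
      rw [Finset.sum_comm]
      exact Finset.sum_congr rfl fun a _ => Finset.sum_congr rfl fun b _ => by ring
    ext i j
    rw [this]
    fin_cases i <;> fin_cases j
    exacts [(h.induced x hx 0 0).symm, (h.induced x hx 0 1).symm, h.normal' hx 0,
      (h.induced x hx 1 0).symm, (h.induced x hx 1 1).symm, h.normal' hx 1, h.normal x hx 0,
      h.normal x hx 1, h.unit x hx]
  have hdet : Q.det ≠ 0 := by
    intro h0
    have h1 := congrArg Matrix.det hgram
    rw [Matrix.det_mul, Matrix.det_transpose, h0, mul_zero, Matrix.det_fin_three] at h1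
    have h2 := (h.source.posDef x hx).det_pos
    rw [Matrix.det_fin_two] at h2
    simp at h1
    linarith
  have hQZ : Q.mulVec ((K (F x)).mulVec Z) = 0 := by
    have : ∀ v, v ⬝ᵥ (K (F x)).mulVec Z = bil (K (F x)) Z v := fun v => by
      rw [h.bil_comm hx, bil_mulVec]
    funext i
    simp only [Matrix.mulVec.eq_1 Q, this, Pi.zero_apply]
    fin_cases i
    · exact hT 0
    · exact hT 1
    · exact hN
  have h1 := Matrix.eq_zero_of_mulVec_eq_zero hdet hQZ
  exact Matrix.eq_zero_of_mulVec_eq_zero (h.metric.posDef _ (h.map.mapsTo hx)).det_pos.ne' h1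

theorem ext (h : IsSurfaceOn G K F ν s W) (hx : x ∈ s) {Z Z' : Fin 3 → ℝ}
    (hT : ∀ j, bil (K (F x)) Z (dMap F j x) = bil (K (F x)) Z' (dMap F j x))
    (hN : bil (K (F x)) Z (ν x) = bil (K (F x)) Z' (ν x)) : Z = Z' := by
  refine sub_eq_zero.1 (h.eq_zero hx (fun j => ?_) ?_)
  · rw [map_sub, LinearMap.sub_apply, hT, sub_self]
  · rw [map_sub, LinearMap.sub_apply, hN, sub_self]

/-- Expansion of a vector in terms of the frame `∂_0 F, ∂_1 F, ν`. -/
theorem expansion (h : IsSurfaceOn G K F ν s W) (hx : x ∈ s) (V : Fin 3 → ℝ) :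
    V = ∑ i, ∑ j, ((G x)⁻¹ i j * bil (K (F x)) V (dMap F j x)) • dMap F i x
      + bil (K (F x)) V (ν x) • ν x := by
  refine h.ext hx (fun l => ?_) ?_
  · simp only [map_add, map_sum, map_smul, LinearMap.add_apply, LinearMap.sum_apply,
      LinearMap.smul_apply, h.normal x hx, ← h.induced x hx, smul_eq_mul, mul_zero, add_zero]
    rw [Finset.sum_comm]
    have : ∀ j, ∑ i, (G x)⁻¹ i j * bil (K (F x)) V (dMap F j x) * G x i l
        = (1 : Matrix (Fin 2) (Fin 2) ℝ) j l * bil (K (F x)) V (dMap F j x) := by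
      intro j
      rw [← h.sum_inv_mul hx, Finset.sum_mul]
      exact Finset.sum_congr rfl fun i _ => by rw [h.source.inv_symm hx]; ring
    simp [this, Matrix.one_apply]
  · simp [h.normal' hx, h.unit x hx]

/-- The Ricci curvature in terms of the frame `∂_0 F, ∂_1 F, ν`. -/
theorem ric_eq (h : IsSurfaceOn G K F ν s W) (hx : x ∈ s) (X Y : Fin 3 → ℝ) :
    ric K (F x) X Y
      = ∑ i, ∑ j, (G x)⁻¹ i j * bil (K (F x)) (curv K (F x) (dMap F i x) X Y) (dMap F j x)
        + bil (K (F x)) (curv K (F x) (ν x) X Y) (ν x) := by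
  have hcurv : ∀ V : Fin 3 → ℝ, curv K (F x) V X Y
      = ∑ c, V c • curv K (F x) (Pi.single c 1) X Y := by
    intro V
    rw [curv_eq_sum]
    refine Finset.sum_congr rfl fun c _ => ?_
    rw [curv_eq_sum (Pi.single c 1)]
    simp [Pi.single_apply, Finset.smul_sum, smul_smul]
  rw [ric_eq_trace]
  -- Each vector `R(e_a, X) Y` is expanded in the frame and its `a`-th component taken; summation
  -- over `a` reassembles the frame vectors in the first slot of `R`.
  have hexp : ∀ a, curv K (F x) (Pi.single a 1) X Y a
      = ∑ i, ∑ j, (G x)⁻¹ i j * (bil (K (F x)) (dMap F i x a •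
          curv K (F x) (Pi.single a 1) X Y) (dMap F j x))
        + bil (K (F x)) (ν x a • curv K (F x) (Pi.single a 1) X Y) (ν x) := by
    intro a
    conv_lhs => rw [h.expansion hx (curv K (F x) (Pi.single a 1) X Y)]
    simp only [Pi.add_apply, Finset.sum_apply, Pi.smul_apply, smul_eq_mul, map_smul,
      LinearMap.smul_apply]
    congr 1
    · exact Finset.sum_congr rfl fun a _ => Finset.sum_congr rfl fun b _ => by ring
    · ring
  rw [Finset.sum_congr rfl fun a _ => hexp a, Finset.sum_add_distrib]
  congr 1
  · rw [Finset.sum_comm]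
    refine Finset.sum_congr rfl fun i _ => ?_
    rw [Finset.sum_comm]
    refine Finset.sum_congr rfl fun j _ => ?_
    rw [← Finset.mul_sum, hcurv (dMap F i x), map_sum, LinearMap.sum_apply]
  · rw [hcurv (ν x), map_sum, LinearMap.sum_apply]

/-- Pair symmetry gives `⟨R(U, X) Y, V⟩ = ⟨R(V, Y) X, U⟩`, and the trace is symmetric in `U` and
`V`. -/
theorem ric_comm (h : IsSurfaceOn G K F ν s W) (hx : x ∈ s) (X Y : Fin 3 → ℝ) :
    ric K (F x) X Y = ric K (F x) Y X := by
  have key : ∀ U V : Fin 3 → ℝ, bil (K (F x)) (curv K (F x) U X Y) V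
      = bil (K (F x)) (curv K (F x) V Y X) U := by
    intro U V
    rw [h.metric.bil_curv_pair (h.map.mapsTo hx), h.metric.bil_curv_antisymm (h.map.mapsTo hx),
      curv_antisymm, map_neg, LinearMap.neg_apply, neg_neg]
  rw [h.ric_eq hx, h.ric_eq hx, Finset.sum_comm]
  congr 1
  · exact Finset.sum_congr rfl fun a _ => Finset.sum_congr rfl fun b _ => by
      rw [key, h.source.inv_symm hx]
  · exact key _ _

/-- The tangential part of the Gauss formula. -/
theorem bil_covAlong_dMap (h : IsSurfaceOn G K F ν s W) (hx : x ∈ s) (i j l : Fin 2) :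
    bil (K (F x)) (covAlong K F (dMap F j) i x) (dMap F l x)
      = ∑ k, christoffel G x k i j * G x k l := by
  have hp : ∀ c a b, pd c (fun y => G y a b) x
      = bil (K (F x)) (covAlong K F (dMap F a) c x) (dMap F b x)
        + bil (K (F x)) (covAlong K F (dMap F b) c x) (dMap F a x) := by
    intro c a b
    rw [pd_congr_of_eqOn h.map.isOpen hx fun y hy => h.induced y hy a b,
      pd_bil h.metric h.map hx (h.smooth_dMap a) (h.smooth_dMap b),
      h.bil_comm hx (dMap F a x)]
  have hs : ∀ a b, covAlong K F (dMap F a) b x = covAlong K F (dMap F b) a x := fun a b =>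
    covAlong_dMap_comm h.metric h.map hx
  -- Koszul's argument: with the derivatives of `G` written through the symmetric `∇dF`, only `⟨∇_i
  -- ∂_j F, ∂_l F⟩` survives.
  have h1 := h.source.sum_mul_christoffel hx l i j
  rw [hp, hp, hp, hs i j, hs l i, hs l j] at h1
  have h2 : ∑ k, christoffel G x k i j * G x k l = ∑ k, G x l k * christoffel G x k i j :=
    Finset.sum_congr rfl fun k _ => by rw [h.source.symm hx]; ring
  rw [h2, h1]
  ring

/-- Differentiate `⟨ν, ∂_j F⟩ = 0`. -/
theorem secondForm_eq (h : IsSurfaceOn G K F ν s W) (hx : x ∈ s) (i j : Fin 2) :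
    secondForm K F ν i j x = bil (K (F x)) (covAlong K F (dMap F j) i x) (ν x) := by
  have h1 := pd_bil (i := i) h.metric h.map hx h.smooth (h.smooth_dMap j)
  rw [pd_congr_of_eqOn (v := fun _ => 0) h.map.isOpen hx fun y hy => h.normal y hy j,
    pd_const, h.bil_comm hx (ν x)] at h1
  simp only [secondForm]
  linarith

theorem secondForm_symm (h : IsSurfaceOn G K F ν s W) (hx : x ∈ s) (i j : Fin 2) :
    secondForm K F ν i j x = secondForm K F ν j i x := by
  rw [h.secondForm_eq hx, h.secondForm_eq hx, covAlong_dMap_comm h.metric h.map hx]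

theorem smooth_covAlong (h : IsSurfaceOn G K F ν s W) (i : Fin 2) (a : Fin 3) :
    ContDiffOn ℝ ∞ (fun y => covAlong K F ν i y a) s :=
  contDiffOn_covAlong h.metric h.map h.smooth i a

theorem smooth_secondForm (h : IsSurfaceOn G K F ν s W) (i j : Fin 2) :
    ContDiffOn ℝ ∞ (secondForm K F ν i j) s :=
  (contDiffOn_bil h.metric h.map (h.smooth_covAlong i) (h.smooth_dMap j)).neg

/-- Differentiate `⟨ν, ν⟩ = 1`. -/
theorem bil_covAlong_normal (h : IsSurfaceOn G K F ν s W) (hx : x ∈ s) (i : Fin 2) :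
    bil (K (F x)) (covAlong K F ν i x) (ν x) = 0 := by
  have h1 := pd_bil (i := i) h.metric h.map hx h.smooth h.smooth
  rw [pd_congr_of_eqOn (v := fun _ => 1) h.map.isOpen hx fun y hy => h.unit y hy,
    pd_const, h.bil_comm hx (ν x)] at h1
  linarith

theorem bil_covAlong_tangent (i l : Fin 2) :
    bil (K (F x)) (covAlong K F ν i x) (dMap F l x) = -secondForm K F ν i l x :=
  (neg_neg _).symm

/-- The Gauss formula. -/
theorem gauss (h : IsSurfaceOn G K F ν s W) (hx : x ∈ s) (i j : Fin 2) :
    covAlong K F (dMap F j) i x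
      = ∑ k, christoffel G x k i j • dMap F k x + secondForm K F ν i j x • ν x := by
  refine h.ext hx (fun l => ?_) ?_
  · rw [h.bil_covAlong_dMap hx]
    simp [h.normal x hx, h.induced x hx]
  · rw [← h.secondForm_eq hx]
    simp [h.normal' hx, h.unit x hx]

theorem shape_eq (i k : Fin 2) :
    shape G K F ν x k i = ∑ j, (G x)⁻¹ k j * secondForm K F ν i j x := by
  simp only [shape, secondForm, bil_apply, mul_neg, Finset.sum_neg_distrib]

/-- The Weingarten formula. -/
theorem weingarten (h : IsSurfaceOn G K F ν s W) (hx : x ∈ s) (i : Fin 2) :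
    covAlong K F ν i x = -∑ k, shape G K F ν x k i • dMap F k x := by
  conv_lhs => rw [h.expansion hx (covAlong K F ν i x)]
  rw [h.bil_covAlong_normal hx, zero_smul, add_zero, ← Finset.sum_neg_distrib]
  simp only [shape_eq, bil_covAlong_tangent, Finset.sum_smul, ← Finset.sum_neg_distrib, mul_neg,
    neg_smul]

theorem meanCurvature_eq (x : Coord 2) :
    2 * meanCurvature G K F ν x = ∑ i, ∑ j, (G x)⁻¹ i j * secondForm K F ν i j x := by
  simp only [meanCurvature, shape_eq]
  push_cast
  ring

theorem smooth_meanCurvature (h : IsSurfaceOn G K F ν s W) :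
    ContDiffOn ℝ ∞ (meanCurvature G K F ν) s := by
  have : meanCurvature G K F ν
      = fun x => 1 / 2 * ∑ i, ∑ j, (G x)⁻¹ i j * secondForm K F ν i j x := by
    funext x
    rw [← meanCurvature_eq]; ring
  rw [this]
  exact contDiffOn_const.mul (ContDiffOn.sum fun i _ => ContDiffOn.sum fun j _ =>
    (h.source.smooth_inv i j).mul (h.smooth_secondForm i j))

/-- The tension field of an isometric immersion is `2 H ν`. -/
theorem tension_eq_smul (h : IsSurfaceOn G K F ν s W) (hx : x ∈ s) :
    tension G K F x = (2 * meanCurvature G K F ν x) • ν x := by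
  rw [tension_eq, meanCurvature_eq]
  simp only [h.gauss hx, add_sub_cancel_left, Finset.sum_smul, smul_smul]

/-- Differentiate `⟨∇_j ν, ν⟩ = 0`. -/
theorem bil_covAlong_covAlong_normal (h : IsSurfaceOn G K F ν s W) (hx : x ∈ s) (i j : Fin 2) :
    bil (K (F x)) (covAlong K F (covAlong K F ν j) i x) (ν x)
      = -bil (K (F x)) (covAlong K F ν j x) (covAlong K F ν i x) := by
  have h1 := pd_bil (i := i) h.metric h.map hx (h.smooth_covAlong j) h.smooth
  rw [pd_congr_of_eqOn (v := fun _ => 0) h.map.isOpen hx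
    fun y hy => h.bil_covAlong_normal hy j, pd_const] at h1
  linarith

/-- Differentiate `⟨∇_j ν, ∂_l F⟩ = -b_jl`; the normal part of the Gauss formula drops out as `∇_j
ν` is tangent. -/
theorem bil_covAlong_covAlong_tangent (h : IsSurfaceOn G K F ν s W) (hx : x ∈ s)
    (i j l : Fin 2) :
    bil (K (F x)) (covAlong K F (covAlong K F ν j) i x) (dMap F l x)
      = -pd i (secondForm K F ν j l) x
        + ∑ k, christoffel G x k i l * secondForm K F ν j k x := by
  have h1 := pd_bil (i := i) h.metric h.map hx (h.smooth_covAlong j) (h.smooth_dMap l)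
  have h2 : pd i (fun y => bil (K (F y)) (covAlong K F ν j y) (dMap F l y)) x
      = -pd i (secondForm K F ν j l) x := by
    rw [← pd_neg]
    exact congrArg (fun w => pd i w x) (funext fun y => bil_covAlong_tangent j l)
  rw [h2, h.gauss hx] at h1
  simp only [map_add, map_sum, map_smul, smul_eq_mul, h.bil_covAlong_normal hx,
    bil_covAlong_tangent (ν := ν), mul_neg, Finset.sum_neg_distrib, mul_zero, add_zero] at h1
  linarith

theorem bil_roughLaplacian (V Z : Fin 3 → ℝ) (hV : V = roughLaplacian G K F ν x) :
    bil (K (F x)) V Z = ∑ i, ∑ j, (G x)⁻¹ i j *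
      (bil (K (F x)) (covAlong K F (covAlong K F ν j) i x) Z
        - ∑ k, christoffel G x k i j * bil (K (F x)) (covAlong K F ν k x) Z) := by
  rw [hV, roughLaplacian_eq]
  simp

/-- The Christoffel terms are tangent, so `-g^{ij} ⟨∇_i ν, ∇_j ν⟩` remains, which the Weingarten
formula turns into `-|A|²`. -/
theorem bil_roughLaplacian_normal (h : IsSurfaceOn G K F ν s W) (hx : x ∈ s) :
    bil (K (F x)) (roughLaplacian G K F ν x) (ν x) = -shapeNormSq G K F ν x := by
  rw [bil_roughLaplacian _ _ rfl]
  simp only [h.bil_covAlong_covAlong_normal hx, h.bil_covAlong_normal hx, mul_zero,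
    Finset.sum_const_zero, sub_zero, shapeNormSq, ← Finset.sum_neg_distrib, mul_neg]
  refine Finset.sum_congr rfl fun i _ => Finset.sum_congr rfl fun j _ => ?_
  rw [h.bil_comm hx, h.weingarten hx i, h.weingarten hx j]
  simp only [map_neg, map_add, map_smul, LinearMap.neg_apply, LinearMap.add_apply,
    LinearMap.smul_apply, smul_eq_mul, ← h.induced x hx, Fin.sum_univ_two]
  ring

/-- The derivative of the inverse metric. -/
theorem pd_inv (h : IsSurfaceOn G K F ν s W) (hx : x ∈ s) (l i j : Fin 2) :
    pd l (fun y => (G y)⁻¹ i j) x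
      = -∑ k, (G x)⁻¹ i k * christoffel G x j l k - ∑ k, christoffel G x i l k * (G x)⁻¹ k j := by
  set P := (G x)⁻¹ with hP
  set D : Matrix (Fin 2) (Fin 2) ℝ := Matrix.of fun i j => pd l (fun y => (G y)⁻¹ i j) x with hD
  set E : Matrix (Fin 2) (Fin 2) ℝ := Matrix.of fun i j => pd l (fun y => G y i j) x with hE
  set C : Matrix (Fin 2) (Fin 2) ℝ := Matrix.of fun k a => christoffel G x k l a with hC
  have d1 : ∀ i j, DifferentiableAt ℝ (fun y => (G y)⁻¹ i j) x := fun i j =>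
    differentiableAt_of_contDiffOn (h.source.smooth_inv i j) h.map.isOpen hx
  have d2 : ∀ i j, DifferentiableAt ℝ (fun y => G y i j) x := fun i j =>
    differentiableAt_of_contDiffOn (h.source.smooth i j) h.map.isOpen hx
  -- Differentiate `G⁻¹ G = 1`; since `G` is parallel, solving for the derivative of the inverse
  -- shows that it is parallel too.
  have h1 : D * G x + P * E = 0 := by
    ext i j
    have := pd_sum_mul (i := l) (t := Finset.univ) (w := fun k y => (G y)⁻¹ i k)
      (z := fun k y => G y k j) (fun k _ => d1 i k) (fun k _ => d2 k j)
    rw [pd_congr_of_eqOn h.map.isOpen hx fun y hy => h.sum_inv_mul hy i j, pd_const,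
      Finset.sum_add_distrib] at this
    simpa [Matrix.mul_apply, hD, hE, hP] using this.symm
  have h2 : E = C.transpose * G x + G x * C := by
    ext a b
    simp only [hE, h.source.pd_eq hx, Matrix.add_apply, Matrix.mul_apply, Matrix.transpose_apply,
      hC, Matrix.of_apply]
    congr 1
    exact Finset.sum_congr rfl fun k _ => by ring
  have h3 : D = -(P * C.transpose) - C * P := by
    have hGP : G x * P = 1 := h.source.mul_inv hx
    have hPG : P * G x = 1 := h.source.inv_mul hx
    have e1 : (D * G x + P * E) * P = D + P * C.transpose + C * P := by
      rw [h2, add_mul, mul_add P, ← mul_assoc P (G x), hPG, add_mul, mul_assoc, hGP, mul_assoc,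
        mul_assoc, hGP]
      simp [add_assoc]
    rw [h1, zero_mul] at e1
    rw [eq_comm, sub_eq_iff_eq_add, neg_eq_iff_add_eq_zero]
    rw [e1]
    abel
  have := congrFun (congrFun h3 i) j
  simpa [Matrix.mul_apply, hD, hC] using this

/-- The trace of the Codazzi equation. -/
theorem bil_roughLaplacian_tangent (h : IsSurfaceOn G K F ν s W) (hx : x ∈ s) (l : Fin 2) :
    bil (K (F x)) (roughLaplacian G K F ν x) (dMap F l x)
      = -(2 * pd l (meanCurvature G K F ν) x) + ric K (F x) (dMap F l x) (ν x) := by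
  have d1 : ∀ i j, DifferentiableAt ℝ (fun y => (G y)⁻¹ i j) x := fun i j =>
    differentiableAt_of_contDiffOn (h.source.smooth_inv i j) h.map.isOpen hx
  have d2 : ∀ i j, DifferentiableAt ℝ (secondForm K F ν i j) x := fun i j =>
    differentiableAt_of_contDiffOn (h.smooth_secondForm i j) h.map.isOpen hx
  have hH : 2 * pd l (meanCurvature G K F ν) x
      = ∑ i, ∑ j, (pd l (fun y => (G y)⁻¹ i j) x * secondForm K F ν i j x
        + (G x)⁻¹ i j * pd l (secondForm K F ν i j) x) := by
    rw [← pd_const_mul _ (differentiableAt_of_contDiffOn h.smooth_meanCurvature h.map.isOpen hx)]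
    simp only [meanCurvature_eq]
    rw [pd_sum fun i _ => DifferentiableAt.fun_sum fun j _ => (d1 i j).fun_mul (d2 i j)]
    exact Finset.sum_congr rfl fun i _ => pd_sum_mul (fun j _ => d1 i j) (fun j _ => d2 i j)
  -- The Codazzi equation: the tangential part of `[∇_i, ∇_l] ν = R(∂_i F, ∂_l F) ν`.
  have hcod : ∀ i j, -pd i (secondForm K F ν l j) x
        + ∑ k, christoffel G x k i j * secondForm K F ν l k x
      = -pd l (secondForm K F ν i j) x + ∑ k, christoffel G x k l j * secondForm K F ν i k x
        + bil (K (F x)) (curv K (F x) (dMap F i x) (dMap F l x) (ν x)) (dMap F j x) := by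
    intro i j
    rw [← covAlong_covAlong_sub h.metric h.map hx h.smooth, map_sub, LinearMap.sub_apply,
      h.bil_covAlong_covAlong_tangent hx, h.bil_covAlong_covAlong_tangent hx]
    ring
  have hps : ∀ i j, pd i (secondForm K F ν j l) x = pd i (secondForm K F ν l j) x := fun i j =>
    pd_congr_of_eqOn h.map.isOpen hx fun y hy => h.secondForm_symm hy j l
  -- Codazzi moves the derivative from `∂_i b_jl` to `∂_l b_ij`, whose trace is a part of `∂_l (2
  -- H)`.
  have hterm : ∀ i j, bil (K (F x)) (covAlong K F (covAlong K F ν j) i x) (dMap F l x)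
        - ∑ k, christoffel G x k i j * bil (K (F x)) (covAlong K F ν k x) (dMap F l x)
      = -pd l (secondForm K F ν i j) x + ∑ k, christoffel G x k l j * secondForm K F ν i k x
        + ∑ k, christoffel G x k l i * secondForm K F ν j k x
        + bil (K (F x)) (curv K (F x) (dMap F i x) (dMap F l x) (ν x)) (dMap F j x) := by
    intro i j
    rw [h.bil_covAlong_covAlong_tangent hx, hps]
    simp only [bil_covAlong_tangent, mul_neg, Finset.sum_neg_distrib, sub_neg_eq_add]
    have e1 : ∑ k, christoffel G x k i j * secondForm K F ν k l x
        = ∑ k, christoffel G x k i j * secondForm K F ν l k x :=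
      Finset.sum_congr rfl fun k _ => by rw [h.secondForm_symm hx]
    have e2 : ∑ k, christoffel G x k i l * secondForm K F ν j k x
        = ∑ k, christoffel G x k l i * secondForm K F ν j k x :=
      Finset.sum_congr rfl fun k _ => by rw [h.source.christoffel_symm hx]
    rw [e1, e2]
    linarith [hcod i j]
  have hric : ric K (F x) (dMap F l x) (ν x) = ∑ i, ∑ j, (G x)⁻¹ i j *
      bil (K (F x)) (curv K (F x) (dMap F i x) (dMap F l x) (ν x)) (dMap F j x) := by
    rw [h.ric_eq hx, h.metric.bil_curv_antisymm (h.map.mapsTo hx) (ν x)]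
    have : bil (K (F x)) (curv K (F x) (ν x) (dMap F l x) (ν x)) (ν x) = 0 := by
      have := h.metric.bil_curv_antisymm (h.map.mapsTo hx) (ν x) (dMap F l x) (ν x) (ν x)
      linarith
    rw [this, neg_zero, add_zero]
  rw [bil_roughLaplacian _ _ rfl, hH, hric]
  -- The remaining Christoffel terms are those of `∂_l g^{ij}`, which completes the derivative of `2
  -- H`.
  simp only [hterm, h.pd_inv hx, mul_add, Finset.sum_add_distrib]
  have hs := h.secondForm_symm hx 0 1
  have hP := h.source.inv_symm hx 0 1
  simp only [Fin.sum_univ_two]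
  rw [hs, hP]
  ring

/-- Antisymmetry in the last two slots turns the trace into `-Ric`; the normal direction missing
from the trace contributes `R(ν, ν) = 0`. -/
theorem bil_curvTrace_normal (h : IsSurfaceOn G K F ν s W) (hx : x ∈ s) :
    bil (K (F x)) (curvTrace G K F x (ν x)) (ν x) = -ric K (F x) (ν x) (ν x) := by
  rw [h.ric_eq hx, curv_self]
  simp only [curvTrace, map_sum, map_smul, LinearMap.sum_apply, LinearMap.smul_apply, smul_eq_mul,
    map_zero, LinearMap.zero_apply, add_zero, ← Finset.sum_neg_distrib]
  exact Finset.sum_congr rfl fun i _ => Finset.sum_congr rfl fun j _ => by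
    rw [h.metric.bil_curv_antisymm (h.map.mapsTo hx)]; ring

theorem bil_curvTrace_tangent (h : IsSurfaceOn G K F ν s W) (hx : x ∈ s) (l : Fin 2) :
    bil (K (F x)) (curvTrace G K F x (ν x)) (dMap F l x)
      = -ric K (F x) (ν x) (dMap F l x) := by
  rw [h.ric_eq hx, curv_self]
  simp only [curvTrace, map_sum, map_smul, LinearMap.sum_apply, LinearMap.smul_apply, smul_eq_mul,
    map_zero, LinearMap.zero_apply, add_zero, ← Finset.sum_neg_distrib]
  exact Finset.sum_congr rfl fun i _ => Finset.sum_congr rfl fun j _ => by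
    rw [h.metric.bil_curv_antisymm (h.map.mapsTo hx)]; ring

/-- The gradient term of the Leibniz rule is tangent and does not contribute. -/
theorem jacobiOp_smul_normal (h : IsSurfaceOn G K F ν s W) (hx : x ∈ s)
    (hu : ContDiffOn ℝ ∞ u s) :
    bil (K (F x)) (jacobiOp G K F (fun y => u y • ν y) x) (ν x)
      = laplacian G u x - u x * (shapeNormSq G K F ν x - ricciNormal K F ν x) := by
  rw [jacobiOp, roughLaplacian_smul h.source h.metric h.map hx hu h.smooth, curvTrace_smul]
  simp only [map_add, map_sub, map_smul, map_sum, LinearMap.add_apply, LinearMap.sub_apply,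
    LinearMap.smul_apply, LinearMap.sum_apply, smul_eq_mul, h.bil_roughLaplacian_normal hx,
    h.unit x hx, h.bil_covAlong_normal hx, h.bil_curvTrace_normal hx, mul_zero,
    Finset.sum_const_zero]
  change _ = laplacian G u x - u x * (shapeNormSq G K F ν x - ric K (F x) (ν x) (ν x))
  ring

/-- The gradient term gives `-2 A(grad u)`. The Ricci term occurs twice, from the traced Codazzi
equation and from the curvature trace, so the common factor is `-2`. -/
theorem jacobiOp_smul_tangent (h : IsSurfaceOn G K F ν s W) (hx : x ∈ s)
    (hu : ContDiffOn ℝ ∞ u s) (l : Fin 2) :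
    bil (K (F x)) (jacobiOp G K F (fun y => u y • ν y) x) (dMap F l x)
      = -2 * (∑ k, secondForm K F ν k l x * grad G u x k
        + u x * (pd l (meanCurvature G K F ν) x - ric K (F x) (ν x) (dMap F l x))) := by
  rw [jacobiOp, roughLaplacian_smul h.source h.metric h.map hx hu h.smooth, curvTrace_smul]
  simp only [map_add, map_sub, map_smul, map_sum, LinearMap.add_apply, LinearMap.sub_apply,
    LinearMap.smul_apply, LinearMap.sum_apply, smul_eq_mul, h.bil_roughLaplacian_tangent hx,
    h.normal x hx, bil_covAlong_tangent, h.bil_curvTrace_tangent hx, mul_zero,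
    h.ric_comm hx (dMap F l x)]
  simp only [Fin.sum_univ_two]
  ring

end IsSurfaceOn

/-- An identity of functions, free of differentiability hypotheses, so that it also rewrites under
the second derivative of the Laplacian. -/
theorem pd_const_mul_field {m : ℕ} (c : ℝ) (u : Coord m → ℝ) (i : Fin m) :
    pd i (fun y => c * u y) = fun y => c * pd i u y := by
  funext y
  have := congrFun (fderiv_const_smul_field (𝕜 := ℝ) c (f := u)) y
  simp only [pd]
  change fderiv ℝ (c • u) y _ = _
  rw [this]
  simp

theorem grad_const_mul (c : ℝ) (u : Coord 2 → ℝ) (k : Fin 2) :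
    grad G (fun y => c * u y) x k = c * grad G u x k := by
  simp only [grad, pd_const_mul_field, Finset.mul_sum]
  exact Finset.sum_congr rfl fun l _ => by ring

theorem laplacian_const_mul (c : ℝ) (u : Coord 2 → ℝ) :
    laplacian G (fun y => c * u y) x = c * laplacian G u x := by
  simp only [laplacian, pd_const_mul_field, Finset.mul_sum, mul_sub]
  exact Finset.sum_congr rfl fun i _ => Finset.sum_congr rfl fun j _ => by
    congr 1
    · ring
    · exact Finset.sum_congr rfl fun k _ => by ring

/-- The `f`-bitension field of an isometric immersion vanishes iff the system holds. -/
theorem IsSurfaceOn.fBitension_eq_zero_iff {f : Coord 2 → ℝ} (h : IsSurfaceOn G K F ν s W)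
    (hx : x ∈ s) (hf : ContDiffOn ℝ ∞ f s) :
    fBitension G K f F x = 0 ↔ SystemAt G K f F ν x := by
  set w : Coord 2 → ℝ := fun y => f y * meanCurvature G K F ν y with hw
  have hws : ContDiffOn ℝ ∞ (fun y => 2 * w y) s :=
    contDiffOn_const.mul (hf.mul h.smooth_meanCurvature)
  -- The field `f τ` equals `2 f H ν = 2 w ν`.
  have hJ : fBitension G K f F x = jacobiOp G K F (fun y => (2 * w y) • ν y) x := by
    rw [fBitension_eq_jacobiOp h.source h.metric h.map hx hf
      (contDiffOn_tension h.source h.metric h.map)]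
    refine jacobiOp_congr (Filter.eventuallyEq_of_mem (h.map.isOpen.mem_nhds hx) fun y hy => ?_)
    simp only [h.tension_eq_smul hy, smul_smul, hw]
    congr 1
    ring
  have hN := h.jacobiOp_smul_normal hx hws
  have hT := h.jacobiOp_smul_tangent hx hws
  rw [← hJ, laplacian_const_mul] at hN
  simp only [← hJ, grad_const_mul] at hT
  -- `Z` is the tangential equation of the system with its index lowered; the invertible `G⁻¹`
  -- raises it again.
  set Z : Fin 2 → ℝ := fun l => ∑ k, secondForm K F ν k l x * grad G w x k
    + w x * (pd l (meanCurvature G K F ν) x - ric K (F x) (ν x) (dMap F l x)) with hZ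
  have hTZ : ∀ l, bil (K (F x)) (fBitension G K f F x) (dMap F l x) = -4 * Z l := by
    intro l
    rw [hT, hZ]
    simp only [Fin.sum_univ_two]
    ring
  have hsys : ∀ k, ∑ i, shape G K F ν x k i * grad G w x i
      + f x * meanCurvature G K F ν x
        * (grad G (meanCurvature G K F ν) x k - ricciTangent G K F ν x k)
      = ((G x)⁻¹).mulVec Z k := by
    intro k
    have hr : ∀ l, ∑ a, ∑ b, ricci K (F x) a b * ν x a * dMap F l x b
        = ric K (F x) (ν x) (dMap F l x) := fun l => rfl
    simp only [IsSurfaceOn.shape_eq, ricciTangent, hr, Matrix.mulVec, dotProduct, hZ]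
    simp only [grad, Fin.sum_univ_two, hw]
    ring
  have h0 : fBitension G K f F x = 0 ↔
      bil (K (F x)) (fBitension G K f F x) (ν x) = 0 ∧ Z = 0 := by
    constructor
    · intro h0
      refine ⟨by simp [h0], funext fun l => ?_⟩
      have := hTZ l
      rw [h0] at this
      simp at this
      simpa using this
    · rintro ⟨h1, h2⟩
      exact h.eq_zero hx (fun l => by rw [hTZ, h2]; simp) h1
  have h1 : Z = 0 ↔ ∀ k, ((G x)⁻¹).mulVec Z k = 0 := by
    constructor
    · intro h k
      simp [h]
    · intro hk
      have : (G x).mulVec (((G x)⁻¹).mulVec Z) = 0 := by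
        rw [show ((G x)⁻¹).mulVec Z = 0 from funext hk, Matrix.mulVec_zero]
      rwa [Matrix.mulVec_mulVec, h.source.mul_inv hx, Matrix.one_mulVec] at this
  rw [h0, h1, SystemAt]
  simp only [← hw, hsys, hN]
  refine and_congr_left fun _ => ?_
  constructor <;> intro h2 <;> linarith

end Surface

/-! ### Tangent vectors in charts -/

section Charts

variable {k m n : ℕ}
variable {M : Type*} [TopologicalSpace M] [ChartedSpace (Coord m) M]
variable {Q : Type*} [TopologicalSpace Q] [ChartedSpace (Coord k) Q]
variable {e : OpenPartialHomeomorph M (Coord m)}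

theorem mdifferentiable_chart (he : e ∈ IsManifold.maximalAtlas (𝓡 m) ∞ M) :
    e.MDifferentiable (𝓡 m) (𝓡 m) :=
  ⟨(contMDiffOn_of_mem_maximalAtlas he).mdifferentiableOn (by simp),
    (contMDiffOn_symm_of_mem_maximalAtlas he).mdifferentiableOn (by simp)⟩

theorem mfderiv_chart_apply_symm (he : e ∈ IsManifold.maximalAtlas (𝓡 m) ∞ M) {x : Coord m}
    (hx : x ∈ e.target) (v : Coord m) :
    mfderiv (𝓡 m) (𝓡 m) e (e.symm x) (mfderiv (𝓡 m) (𝓡 m) e.symm x v) = v :=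
  congrArg (fun L => L v) ((mdifferentiable_chart he).symm.symm_comp_deriv (x := x) hx)

theorem mfderiv_chart_symm_apply (he : e ∈ IsManifold.maximalAtlas (𝓡 m) ∞ M) {x : Coord m}
    (hx : x ∈ e.target) (v : TangentSpace (𝓡 m) (e.symm x)) :
    mfderiv (𝓡 m) (𝓡 m) e.symm x (mfderiv (𝓡 m) (𝓡 m) e (e.symm x) v) = v := by
  have h1 := (mdifferentiable_chart he).symm_comp_deriv (e.map_target hx)
  have h2 := congrArg (fun L => L v) h1
  -- The composed derivative is based at `e (e.symm x)`, equal to `x` only propositionally; the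
  -- fibres are all the model space, so the values can be compared there.
  have h3 : ∀ y, y = x → ∀ u : Coord m, (show Coord m from mfderiv (𝓡 m) (𝓡 m) e.symm y u)
      = (show Coord m from mfderiv (𝓡 m) (𝓡 m) e.symm x u) := by
    rintro _ rfl u
    rfl
  exact (h3 _ (e.right_inv hx) _).symm.trans h2

theorem mfderiv_chart_apply_symm_of_mem (he : e ∈ IsManifold.maximalAtlas (𝓡 m) ∞ M) {p : M}
    (hp : p ∈ e.source) (v : Coord m) :
    (show Coord m from mfderiv (𝓡 m) (𝓡 m) e p
      (show Coord m from mfderiv (𝓡 m) (𝓡 m) e.symm (e p) v)) = v := by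
  obtain ⟨x, hx, rfl⟩ : ∃ x ∈ e.target, e.symm x = p := ⟨e p, e.map_source hp, e.left_inv hp⟩
  rw [e.right_inv hx]
  exact mfderiv_chart_apply_symm he hx v

theorem tangentBundle_mk_congr {y z : M} (hyz : y = z) (v : Coord m) :
    (⟨y, v⟩ : TangentBundle (𝓡 m) M) = ⟨z, v⟩ := by
  subst hyz
  rfl

variable [IsManifold (𝓡 m) ∞ M]

/-- The vector field with components `X`, along a map with coordinates `B`, is smooth. -/
theorem contMDiffOn_mfderiv_chart_symm (he : e ∈ IsManifold.maximalAtlas (𝓡 m) ∞ M)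
    {s : Set Q} {B X : Q → Coord m} (hB : ContMDiffOn (𝓡 k) (𝓡 m) ∞ B s)
    (hX : ContMDiffOn (𝓡 k) (𝓡 m) ∞ X s) (hs : Set.MapsTo B s e.target) :
    ContMDiffOn (𝓡 k) (𝓡 m).tangent ∞
      (fun q => (⟨e.symm (B q), mfderiv (𝓡 m) (𝓡 m) e.symm (B q) (X q)⟩ :
        TangentBundle (𝓡 m) M)) s := by
  have : IsManifold (𝓡 m) 1 M := IsManifold.of_le (n := ∞) (by simp)
  have h1 := (contMDiffOn_symm_of_mem_maximalAtlas he).contMDiffOn_tangentMapWithin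
    (m := ∞) (by simp) e.open_target.uniqueMDiffOn
  have h2 : ContMDiffOn (𝓡 k) (𝓡 m).tangent ∞
      (fun q => (⟨B q, X q⟩ : TangentBundle (𝓡 m) (Coord m))) s := by
    -- The tangent bundle of the model space is a product, so smoothness of the pair `(B, X)`
    -- suffices.
    refine ContMDiff.comp_contMDiffOn (g := (tangentBundleModelSpaceHomeomorph (𝓡 m)).symm)
      (f := fun q => (B q, X q)) ?_ (hB.prodMk hX)
    convert! contMDiff_tangentBundleModelSpaceHomeomorph_symm (I := 𝓡 m)
    rw [chartedSpaceSelf_prod]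
    rfl
  refine (h1.comp h2 fun q hq => hs hq).congr fun q hq => ?_
  simp only [Function.comp_apply, tangentMapWithin]
  rw [mfderivWithin_of_isOpen e.open_target (hs hq)]

/-- The components of a smooth vector field along a map are smooth. -/
theorem contMDiffOn_mfderiv_chart (he : e ∈ IsManifold.maximalAtlas (𝓡 m) ∞ M)
    {s : Set Q} {Z : Q → TangentBundle (𝓡 m) M} (hZ : ContMDiffOn (𝓡 k) (𝓡 m).tangent ∞ Z s)
    (hs : ∀ q ∈ s, (Z q).1 ∈ e.source) :
    ContMDiffOn (𝓡 k) (𝓡 m) ∞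
      (fun q => (show Coord m from mfderiv (𝓡 m) (𝓡 m) e (Z q).1 (Z q).2)) s := by
  have : IsManifold (𝓡 m) 1 M := IsManifold.of_le (n := ∞) (by simp)
  have h1 := (contMDiffOn_of_mem_maximalAtlas he).contMDiffOn_tangentMapWithin
    (m := ∞) (by simp) e.open_source.uniqueMDiffOn
  have h2 := (contMDiff_snd_tangentBundle_modelSpace (Coord m) (𝓡 m) (n := ∞)).comp_contMDiffOn
    (h1.comp hZ fun q hq => hs q hq)
  refine h2.congr fun q hq => ?_
  exact (congrArg (fun L => L (Z q).2) (mfderivWithin_of_isOpen (I := 𝓡 m) (I' := 𝓡 m) (f := e)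
    e.open_source (hs q hq))).symm

theorem bilin_eq_sum {T : Type*} [AddCommGroup T] [Module ℝ T] [TopologicalSpace T]
    (B : T →L[ℝ] T →L[ℝ] ℝ) (L : Coord m →L[ℝ] T) (v w : Coord m) :
    B (L v) (L w) = ∑ i, ∑ j, B (L (EuclideanSpace.single i 1)) (L (EuclideanSpace.single j 1))
      * v i * w j := by
  conv_lhs => rw [coord_eq_sum v, coord_eq_sum w]
  simp only [map_sum, map_smul, sum_apply, smul_apply, smul_eq_mul, Finset.mul_sum]
  rw [Finset.sum_comm]
  exact Finset.sum_congr rfl fun i _ => Finset.sum_congr rfl fun j _ => by ring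

/-- The metric in the coordinates of a chart. -/
theorem metric_mfderiv_chart_symm
    (g : Bundle.ContMDiffRiemannianMetric (𝓡 m) ∞ (Coord m) (fun p : M => TangentSpace (𝓡 m) p))
    (x v w : Coord m) :
    metricField g (e.symm x) (mfderiv (𝓡 m) (𝓡 m) e.symm x v) (mfderiv (𝓡 m) (𝓡 m) e.symm x w)
      = bil (metricInChart (metricField g) e x) (fun i => v i) (fun i => w i) := by
  rw [bil_apply]
  let L : Coord m →L[ℝ] TangentSpace (𝓡 m) (e.symm x) := mfderiv (𝓡 m) (𝓡 m) e.symm x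
  exact bilin_eq_sum (g.inner (e.symm x)) L v w

theorem metric_eq_bil (he : e ∈ IsManifold.maximalAtlas (𝓡 m) ∞ M)
    (g : Bundle.ContMDiffRiemannianMetric (𝓡 m) ∞ (Coord m) (fun p : M => TangentSpace (𝓡 m) p))
    {p : M} (hp : p ∈ e.source) (v w : TangentSpace (𝓡 m) p) :
    metricField g p v w = bil (metricInChart (metricField g) e (e p))
      (fun i => (show Coord m from mfderiv (𝓡 m) (𝓡 m) e p v) i)
      (fun i => (show Coord m from mfderiv (𝓡 m) (𝓡 m) e p w) i) := by
  obtain ⟨x, hx, rfl⟩ : ∃ x ∈ e.target, e.symm x = p := ⟨e p, e.map_source hp, e.left_inv hp⟩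
  rw [e.right_inv hx, ← metric_mfderiv_chart_symm]
  congr 1
  · exact (mfderiv_chart_symm_apply he hx v).symm
  · exact (mfderiv_chart_symm_apply he hx w).symm

theorem posDef_of_bil_pos {B : Matrix (Fin n) (Fin n) ℝ} (hB : ∀ a b, B a b = B b a)
    (hpos : ∀ v : Fin n → ℝ, v ≠ 0 → 0 < bil B v v) : B.PosDef := by
  refine Matrix.PosDef.of_dotProduct_mulVec_pos (Matrix.IsHermitian.ext fun i j => ?_) ?_
  · simpa using hB j i
  · intro v hv
    rw [star_trivial, ← bil_mulVec]
    exact hpos v hv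

/-- The entries are the smooth metric evaluated on the smooth coordinate fields; positivity holds
because the derivative of `e.symm` is injective. -/
theorem isMetricOn_metricInChart (he : e ∈ IsManifold.maximalAtlas (𝓡 m) ∞ M)
    (g : Bundle.ContMDiffRiemannianMetric (𝓡 m) ∞ (Coord m)
      (fun p : M => TangentSpace (𝓡 m) p)) :
    IsMetricOn (metricInChart (metricField g) e) e.target where
  isOpen := e.open_target
  smooth i j := by
    have hv : ∀ i : Fin m, ContMDiffOn (𝓡 m) (𝓡 m).tangent ∞
        (fun x => (⟨e.symm x, mfderiv (𝓡 m) (𝓡 m) e.symm x (EuclideanSpace.single i (1 : ℝ))⟩ :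
          TangentBundle (𝓡 m) M)) e.target := fun i =>
      contMDiffOn_mfderiv_chart_symm he contMDiffOn_id contMDiffOn_const fun _ hx => hx
    have h1 : ContMDiffOn (𝓡 m) ((𝓡 m).prod 𝓘(ℝ)) ∞ (fun x =>
        Bundle.TotalSpace.mk' ℝ (E := Bundle.Trivial M ℝ) (e.symm x)
          (metricInChart (metricField g) e x i j)) e.target := by
      apply ContMDiffOn.clm_bundle_apply₂ (F₁ := Coord m) (F₂ := Coord m)
      · exact g.contMDiff.comp_contMDiffOn (contMDiffOn_symm_of_mem_maximalAtlas he)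
      · exact hv i
      · exact hv j
    rw [← contMDiffOn_iff_contDiffOn]
    intro x hx
    have := h1 x hx
    simp only [Bundle.contMDiffWithinAt_totalSpace] at this
    exact this.2
  posDef x hx := by
    refine posDef_of_bil_pos (fun a b => g.symm _ _ _) fun v hv => ?_
    have h1 := metric_mfderiv_chart_symm (e := e) g x (WithLp.toLp 2 v) (WithLp.toLp 2 v)
    refine lt_of_lt_of_eq (g.pos _ _ fun h0 => hv ?_) h1
    have h2 := mfderiv_chart_apply_symm he hx (WithLp.toLp 2 v)
    rw [h0, map_zero] at h2
    exact congrArg (fun u : Coord m => (fun i => u i)) h2.symm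

end Charts

/-! ### Unit normal fields in coordinates -/

section Restriction

variable {m n : ℕ}

theorem IsMetricOn.mono {K : Coord n → Matrix (Fin n) (Fin n) ℝ} {W W' : Set (Coord n)}
    (hK : IsMetricOn K W) (hW' : IsOpen W') (h : W' ⊆ W) : IsMetricOn K W' :=
  ⟨hW', fun a b => (hK.smooth a b).mono h, fun y hy => hK.posDef y (h hy)⟩

theorem IsSmoothMapOn.mono {F : Coord m → Coord n} {s s' : Set (Coord m)} {W : Set (Coord n)}
    (hF : IsSmoothMapOn F s W) (hs' : IsOpen s') (h : s' ⊆ s) : IsSmoothMapOn F s' W :=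
  ⟨hs', hF.smooth.mono h, hF.mapsTo.mono_left h⟩

end Restriction

section Normal

variable {G : Coord 2 → Matrix (Fin 2) (Fin 2) ℝ} {K : Coord 3 → Matrix (Fin 3) (Fin 3) ℝ}
  {F : Coord 2 → Coord 3} {s : Set (Coord 2)} {W : Set (Coord 3)}

/-- Pairing a linear relation with both tangent vectors gives a vector in the kernel of the
invertible Gram matrix. -/
theorem linearIndependent_dMap (hG : IsMetricOn G s)
    (hind : ∀ x ∈ s, ∀ i j, G x i j = bil (K (F x)) (dMap F i x) (dMap F j x))
    {x : Coord 2} (hx : x ∈ s) : LinearIndependent ℝ ![dMap F 0 x, dMap F 1 x] := by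
  rw [LinearIndependent.pair_iff]
  intro a b hab
  have h0 : ∀ j, (G x).transpose.mulVec ![a, b] j = 0 := by
    intro j
    have := congrArg (fun Z => bil (K (F x)) Z (dMap F j x)) hab
    simp only [map_add, map_smul, LinearMap.add_apply, LinearMap.smul_apply, ← hind x hx,
      smul_eq_mul, map_zero, LinearMap.zero_apply] at this
    rw [Matrix.mulVec, dotProduct, Fin.sum_univ_two, ← this]
    simp only [Matrix.transpose_apply, Matrix.cons_val_zero, Matrix.cons_val_one]
    ring
  have hdet : (G x).transpose.det ≠ 0 := by
    rw [Matrix.det_transpose]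
    exact (hG.posDef x hx).det_pos.ne'
  have hz := Matrix.eq_zero_of_mulVec_eq_zero hdet (funext h0)
  exact ⟨congrFun hz 0, congrFun hz 1⟩

/-- An immersed surface in coordinates has a smooth unit normal field. -/
theorem exists_isSurfaceOn (hK : IsMetricOn K W) (hF : IsSmoothMapOn F s W) (hG : IsMetricOn G s)
    (hind : ∀ x ∈ s, ∀ i j, G x i j = bil (K (F x)) (dMap F i x) (dMap F j x)) :
    ∃ ν, IsSurfaceOn G K F ν s W := by
  -- The Euclidean cross product is a covector annihilating the tangent plane; `K⁻¹` raises it to a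
  -- vector `w` normal for `K`, which is then normalised.
  set c : Coord 2 → Fin 3 → ℝ := fun x => crossProduct (dMap F 0 x) (dMap F 1 x) with hc
  set w : Coord 2 → Fin 3 → ℝ := fun x => ((K (F x))⁻¹).mulVec (c x) with hw
  have hKw : ∀ x ∈ s, (K (F x)).mulVec (w x) = c x := fun x hx => by
    rw [hw, Matrix.mulVec_mulVec, hK.mul_inv (hF.mapsTo hx), Matrix.one_mulVec]
  have hpos : ∀ x ∈ s, 0 < bil (K (F x)) (w x) (w x) := by
    intro x hx
    refine bil_pos (hK.posDef _ (hF.mapsTo hx)) fun h0 => ?_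
    have hcx : c x ≠ 0 :=
      crossProduct_ne_zero_iff_linearIndependent.2 (linearIndependent_dMap hG hind hx)
    exact hcx (by rw [← hKw x hx, h0, Matrix.mulVec_zero])
  have hcs : ∀ a, ContDiffOn ℝ ∞ (fun x => c x a) s := by
    have hd := fun i a => contDiffOn_dMap hF.isOpen hF.smooth i a
    intro a
    simp only [hc, cross_apply]
    fin_cases a
    · exact ((hd 0 1).mul (hd 1 2)).sub ((hd 0 2).mul (hd 1 1))
    · exact ((hd 0 2).mul (hd 1 0)).sub ((hd 0 0).mul (hd 1 2))
    · exact ((hd 0 0).mul (hd 1 1)).sub ((hd 0 1).mul (hd 1 0))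
  have hws : ∀ a, ContDiffOn ℝ ∞ (fun x => w x a) s := by
    intro a
    simp only [hw, Matrix.mulVec, dotProduct]
    exact ContDiffOn.sum fun b _ => ((hK.smooth_inv a b).comp hF.smooth hF.mapsTo).mul (hcs b)
  have hq := contDiffOn_bil hK hF hws hws
  refine ⟨fun x => (√(bil (K (F x)) (w x) (w x)))⁻¹ • w x, hK, hF, hG, hind, fun a => ?_,
    fun x hx => ?_, fun x hx i => ?_⟩
  · exact ((hq.sqrt fun x hx => (hpos x hx).ne').inv
      fun x hx => (Real.sqrt_pos.2 (hpos x hx)).ne').mul (hws a)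
  · have h1 := Real.mul_self_sqrt (hpos x hx).le
    have h2 := (Real.sqrt_pos.2 (hpos x hx)).ne'
    simp only [map_smul, LinearMap.smul_apply, smul_eq_mul]
    field_simp
    linarith
  · have : bil (K (F x)) (w x) (dMap F i x) = 0 := by
      rw [bil_comm (hK.symm (hF.mapsTo hx)), bil_mulVec, hKw x hx]
      fin_cases i
      · exact dot_self_cross _ _
      · exact dot_cross_self _ _
    simp [this]

end Normal

/-! ### Maps in charts -/

section ChartDomain

variable {m n : ℕ} {M N : Type*} [TopologicalSpace M] [TopologicalSpace N] {φ : M → N}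
  {e : OpenPartialHomeomorph M (Coord m)} {e' : OpenPartialHomeomorph N (Coord n)}

/-- The domain of the map `φ` read in charts. -/
def chartDomain (φ : M → N) (e : OpenPartialHomeomorph M (Coord m))
    (e' : OpenPartialHomeomorph N (Coord n)) : Set (Coord m) :=
  e.target ∩ e.symm ⁻¹' (φ ⁻¹' e'.source)

theorem mem_chartDomain {p : M} (hp : p ∈ e.source) (hp' : φ p ∈ e'.source) :
    e p ∈ chartDomain φ e e' :=
  ⟨e.map_source hp, by simpa [e.left_inv hp] using hp'⟩

end ChartDomain

section Maps

variable {m n : ℕ}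
variable {M : Type*} [TopologicalSpace M] [ChartedSpace (Coord m) M]
variable {N : Type*} [TopologicalSpace N] [ChartedSpace (Coord n) N]
variable {e : OpenPartialHomeomorph M (Coord m)} {e' : OpenPartialHomeomorph N (Coord n)}
variable {φ : M → N}

theorem isSmoothMapOn_mapInCharts (he : e ∈ IsManifold.maximalAtlas (𝓡 m) ∞ M)
    (he' : e' ∈ IsManifold.maximalAtlas (𝓡 n) ∞ N) (hφ : ContMDiff (𝓡 m) (𝓡 n) ∞ φ) :
    IsSmoothMapOn (mapInCharts φ e e') (chartDomain φ e e') e'.target where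
  isOpen := e.isOpen_inter_preimage_symm (e'.open_source.preimage hφ.continuous)
  smooth := by
    rw [← contMDiffOn_iff_contDiffOn]
    exact (contMDiffOn_of_mem_maximalAtlas he').comp
      (hφ.comp_contMDiffOn ((contMDiffOn_symm_of_mem_maximalAtlas he).mono fun _ hx => hx.1))
      fun _ hx => hx.2
  mapsTo _ hx := e'.map_source hx.2

theorem mfderiv_mapInCharts (he : e ∈ IsManifold.maximalAtlas (𝓡 m) ∞ M)
    (he' : e' ∈ IsManifold.maximalAtlas (𝓡 n) ∞ N) (hφ : ContMDiff (𝓡 m) (𝓡 n) ∞ φ)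
    {x : Coord m} (hx : x ∈ chartDomain φ e e') (w : Coord m) :
    mfderiv (𝓡 n) (𝓡 n) e' (φ (e.symm x))
        (mfderiv (𝓡 m) (𝓡 n) φ (e.symm x) (mfderiv (𝓡 m) (𝓡 m) e.symm x w))
      = fderiv ℝ (mapInCharts φ e e') x w := by
  have h1 := (mdifferentiable_chart he).mdifferentiableAt_symm hx.1
  have h2 : MDifferentiableAt (𝓡 m) (𝓡 n) φ (e.symm x) := hφ.mdifferentiableAt (by simp)
  have h3 := (mdifferentiable_chart he').mdifferentiableAt hx.2
  rw [← mfderiv_eq_fderiv]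
  change _ = mfderiv (𝓡 m) (𝓡 n) (e' ∘ (φ ∘ e.symm)) x w
  have h4 := mfderiv_comp_apply x (g := e') (f := φ ∘ e.symm) h3 (h2.comp x h1) w
  have h5 := mfderiv_comp_apply x h2 h1 w
  exact (h4.trans (congrArg (mfderiv (𝓡 n) (𝓡 n) e' (φ (e.symm x))) h5)).symm

theorem mfderiv_mapInCharts_single (he : e ∈ IsManifold.maximalAtlas (𝓡 m) ∞ M)
    (he' : e' ∈ IsManifold.maximalAtlas (𝓡 n) ∞ N) (hφ : ContMDiff (𝓡 m) (𝓡 n) ∞ φ)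
    {x : Coord m} (hx : x ∈ chartDomain φ e e') (i : Fin m) :
    (fun a => (show Coord n from mfderiv (𝓡 n) (𝓡 n) e' (φ (e.symm x))
        (mfderiv (𝓡 m) (𝓡 n) φ (e.symm x)
          (mfderiv (𝓡 m) (𝓡 m) e.symm x (EuclideanSpace.single i (1 : ℝ))))) a)
      = dMap (mapInCharts φ e e') i x := by
  have hF := isSmoothMapOn_mapInCharts he he' hφ
  funext a
  rw [dMap_apply (differentiableAt_of_contDiffOn hF.smooth hF.isOpen hx),
    ← mfderiv_mapInCharts he he' hφ hx]

variable [IsManifold (𝓡 n) ∞ N]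

theorem metricInChart_pullbackMetric (he : e ∈ IsManifold.maximalAtlas (𝓡 m) ∞ M)
    (he' : e' ∈ IsManifold.maximalAtlas (𝓡 n) ∞ N) (hφ : ContMDiff (𝓡 m) (𝓡 n) ∞ φ)
    (h : Bundle.ContMDiffRiemannianMetric (𝓡 n) ∞ (Coord n) (fun q : N => TangentSpace (𝓡 n) q))
    {x : Coord m} (hx : x ∈ chartDomain φ e e') (i j : Fin m) :
    metricInChart (pullbackMetric m (metricField h) φ) e x i j
      = bil (metricInChart (metricField h) e' (mapInCharts φ e e' x))
        (dMap (mapInCharts φ e e') i x) (dMap (mapInCharts φ e e') j x) := by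
  rw [← mfderiv_mapInCharts_single he he' hφ hx, ← mfderiv_mapInCharts_single he he' hφ hx]
  exact metric_eq_bil he' h hx.2 _ _

end Maps

/-! ### Surfaces in three-manifolds -/

section SurfaceInCharts

variable {M : Type*} [TopologicalSpace M] [ChartedSpace (Coord 2) M]
variable {N : Type*} [TopologicalSpace N] [ChartedSpace (Coord 3) N] [IsManifold (𝓡 3) ∞ N]
variable {e : OpenPartialHomeomorph M (Coord 2)} {e' : OpenPartialHomeomorph N (Coord 3)}
variable {φ : M → N}
  {h : Bundle.ContMDiffRiemannianMetric (𝓡 3) ∞ (Coord 3) (fun q : N => TangentSpace (𝓡 3) q)}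

/-- Smoothness comes from the Gram formula in the charts, positivity from the injectivity of `dφ`
composed with the derivative of `e.symm`. -/
theorem isMetricOn_pullback (he : e ∈ IsManifold.maximalAtlas (𝓡 2) ∞ M)
    (he' : e' ∈ IsManifold.maximalAtlas (𝓡 3) ∞ N) (hφ : ContMDiff (𝓡 2) (𝓡 3) ∞ φ)
    (himm : ∀ p, Function.Injective (mfderiv (𝓡 2) (𝓡 3) φ p)) :
    IsMetricOn (metricInChart (pullbackMetric 2 (metricField h) φ) e) (chartDomain φ e e') := by
  have hF := isSmoothMapOn_mapInCharts he he' hφ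
  have hK := isMetricOn_metricInChart he' h
  have hd := fun i a => contDiffOn_dMap hF.isOpen hF.smooth i a
  refine ⟨hF.isOpen, fun a b => ?_, fun x hx => ?_⟩
  · exact (contDiffOn_bil hK hF (hd a) (hd b)).congr fun x hx =>
      metricInChart_pullbackMetric he he' hφ h hx a b
  · refine posDef_of_bil_pos (fun a b => h.symm _ _ _) fun v hv => ?_
    let L : Coord 2 →L[ℝ] TangentSpace (𝓡 3) (φ (e.symm x)) :=
      (mfderiv (𝓡 2) (𝓡 3) φ (e.symm x)).comp (mfderiv (𝓡 2) (𝓡 2) e.symm x)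
    have h1 : h.inner (φ (e.symm x)) (L (WithLp.toLp 2 v)) (L (WithLp.toLp 2 v))
        = bil (metricInChart (pullbackMetric 2 (metricField h) φ) e x) v v := by
      rw [bil_apply]
      exact bilin_eq_sum (h.inner (φ (e.symm x))) L _ _
    refine lt_of_lt_of_eq (h.pos _ _ fun h0 => hv ?_) h1
    have h2 : mfderiv (𝓡 2) (𝓡 2) e.symm x (WithLp.toLp 2 v) = 0 :=
      himm _ (h0.trans (map_zero _).symm)
    have h3 := mfderiv_chart_apply_symm he hx.1 (WithLp.toLp 2 v)
    rw [h2, map_zero] at h3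
    exact congrArg (fun u : Coord 2 => (fun i => u i)) h3.symm

/-- A unit normal field of an immersion, read in charts. -/
theorem isSurfaceOn_fieldInCharts (he : e ∈ IsManifold.maximalAtlas (𝓡 2) ∞ M)
    (he' : e' ∈ IsManifold.maximalAtlas (𝓡 3) ∞ N) (hφ : ContMDiff (𝓡 2) (𝓡 3) ∞ φ)
    (himm : ∀ p, Function.Injective (mfderiv (𝓡 2) (𝓡 3) φ p)) {U : Set M} (hU : IsOpen U)
    {ξ : ∀ p : M, TangentSpace (𝓡 3) (φ p)} (hξ : IsUnitNormalOn 2 (metricField h) φ ξ U) :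
    IsSurfaceOn (metricInChart (pullbackMetric 2 (metricField h) φ) e)
      (metricInChart (metricField h) e') (mapInCharts φ e e') (fieldInCharts φ ξ e e')
      (chartDomain φ e e' ∩ (e.target ∩ e.symm ⁻¹' U)) e'.target := by
  have hF := isSmoothMapOn_mapInCharts he he' hφ
  have ho : IsOpen (chartDomain φ e e' ∩ (e.target ∩ e.symm ⁻¹' U)) :=
    hF.isOpen.inter (e.isOpen_inter_preimage_symm hU)
  refine ⟨isMetricOn_metricInChart he' h, hF.mono ho Set.inter_subset_left,
    (isMetricOn_pullback he he' hφ himm).mono ho Set.inter_subset_left,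
    fun x hx => metricInChart_pullbackMetric he he' hφ h hx.1, ?_, fun x hx => ?_,
    fun x hx i => ?_⟩
  · have h1 : ContMDiffOn (𝓡 2) (𝓡 3).tangent ∞
        (fun x => (⟨φ (e.symm x), ξ (e.symm x)⟩ : TangentBundle (𝓡 3) N))
        (chartDomain φ e e' ∩ (e.target ∩ e.symm ⁻¹' U)) :=
      hξ.smooth.comp ((contMDiffOn_symm_of_mem_maximalAtlas he).mono fun _ hx => hx.1.1)
        fun _ hx => hx.2.2
    have h2 := contMDiffOn_mfderiv_chart he' h1 fun x hx => hx.1.2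
    exact fun a => contDiffOn_apply (contMDiffOn_iff_contDiffOn.1 h2) a
  · exact (metric_eq_bil he' h hx.1.2 _ _).symm.trans (hξ.unit _ hx.2.2)
  · rw [← mfderiv_mapInCharts_single he he' hφ hx.1]
    exact (metric_eq_bil he' h hx.1.2 _ _).symm.trans (hξ.normal _ hx.2.2 _)

/-- An immersion has smooth unit normal fields locally. -/
theorem exists_isUnitNormalOn [IsManifold (𝓡 2) ∞ M] (hφ : ContMDiff (𝓡 2) (𝓡 3) ∞ φ)
    (himm : ∀ p, Function.Injective (mfderiv (𝓡 2) (𝓡 3) φ p)) (p : M) :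
    ∃ (U : Set M) (ξ : ∀ p : M, TangentSpace (𝓡 3) (φ p)), IsOpen U ∧ p ∈ U ∧
      IsUnitNormalOn 2 (metricField h) φ ξ U := by
  set e := chartAt (Coord 2) p
  set e' := chartAt (Coord 3) (φ p)
  have he : e ∈ IsManifold.maximalAtlas (𝓡 2) ∞ M := IsManifold.chart_mem_maximalAtlas p
  have he' : e' ∈ IsManifold.maximalAtlas (𝓡 3) ∞ N := IsManifold.chart_mem_maximalAtlas (φ p)
  have hF := isSmoothMapOn_mapInCharts he he' hφ
  obtain ⟨ν, hν⟩ := exists_isSurfaceOn (isMetricOn_metricInChart he' h) hF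
    (isMetricOn_pullback he he' hφ himm) fun x hx => metricInChart_pullbackMetric he he' hφ h hx
  -- The coordinate normal is carried back by the inverse chart; outside the chart domain its values
  -- are irrelevant.
  set ξ : ∀ p : M, TangentSpace (𝓡 3) (φ p) := fun q =>
    (show Coord 3 from mfderiv (𝓡 3) (𝓡 3) e'.symm (e' (φ q)) (WithLp.toLp 2 (ν (e q)))) with hξ
  have hU : ∀ q ∈ e.source ∩ φ ⁻¹' e'.source, ∃ x ∈ chartDomain φ e e', e.symm x = q :=
    fun q hq => ⟨e q, mem_chartDomain hq.1 hq.2, e.left_inv hq.1⟩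
  have hcomp : ∀ x ∈ chartDomain φ e e', (fun a => (show Coord 3 from
      mfderiv (𝓡 3) (𝓡 3) e' (φ (e.symm x)) (ξ (e.symm x))) a) = ν x := by
    intro x hx
    have h1 := mfderiv_chart_apply_symm_of_mem he' hx.2 (WithLp.toLp 2 (ν (e (e.symm x))))
    have h2 := congrArg (fun v : Coord 3 => (fun a => v a)) h1
    refine h2.trans ?_
    simp only [e.right_inv hx.1]
  refine ⟨e.source ∩ φ ⁻¹' e'.source, ξ, e.open_source.inter (e'.open_source.preimage
    hφ.continuous), ⟨mem_chart_source _ p, mem_chart_source _ (φ p)⟩, ?_, fun q hq => ?_,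
    fun q hq v => ?_⟩
  · have hB : ContMDiffOn (𝓡 2) (𝓡 3) ∞ (fun q => e' (φ q)) (e.source ∩ φ ⁻¹' e'.source) :=
      (contMDiffOn_of_mem_maximalAtlas he').comp hφ.contMDiffOn fun _ hq => hq.2
    have hνs : ContDiffOn ℝ ∞ (fun x => WithLp.toLp 2 (ν x)) (chartDomain φ e e') :=
      contDiffOn_piLp' (p := 2) hν.smooth
    have hX : ContMDiffOn (𝓡 2) (𝓡 3) ∞ (fun q => (WithLp.toLp 2 (ν (e q)) : Coord 3))
        (e.source ∩ φ ⁻¹' e'.source) :=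
      (contMDiffOn_iff_contDiffOn.2 hνs).comp
        ((contMDiffOn_of_mem_maximalAtlas he).mono Set.inter_subset_left)
        fun q hq => mem_chartDomain hq.1 hq.2
    refine (contMDiffOn_mfderiv_chart_symm he' hB hX fun q hq => e'.map_source hq.2).congr
      fun q hq => ?_
    exact tangentBundle_mk_congr (e'.left_inv hq.2).symm _
  · obtain ⟨x, hx, rfl⟩ := hU q hq
    rw [metric_eq_bil he' h hx.2, hcomp x hx]
    exact hν.unit x hx
  · obtain ⟨x, hx, rfl⟩ := hU q hq
    rw [metric_eq_bil he' h hx.2, hcomp x hx]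
    -- Every tangent vector comes from a coordinate vector, so orthogonality to `∂_0 F` and `∂_1 F`
    -- suffices.
    obtain ⟨w, rfl⟩ : ∃ w : Coord 2, mfderiv (𝓡 2) (𝓡 2) e.symm x w = v :=
      ⟨_, mfderiv_chart_symm_apply he hx.1 v⟩
    have h1 : (fun a => (show Coord 3 from mfderiv (𝓡 3) (𝓡 3) e' (φ (e.symm x))
        (mfderiv (𝓡 2) (𝓡 3) φ (e.symm x) (mfderiv (𝓡 2) (𝓡 2) e.symm x w))) a)
        = ∑ i, w i • dMap (mapInCharts φ e e') i x := by
      funext a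
      rw [mfderiv_mapInCharts he he' hφ hx]
      conv_lhs => rw [coord_eq_sum w]
      have hd := differentiableAt_of_contDiffOn hF.smooth hF.isOpen hx
      simp [dMap_apply hd]
    rw [h1]
    simp only [map_sum, map_smul]
    have h2 : ∀ i, bil (metricInChart (metricField h) e' (e' (φ (e.symm x)))) (ν x)
        (dMap (mapInCharts φ e e') i x) = 0 := hν.normal x hx
    simp [h2]

/-- The `f`-bitension field of an immersion vanishes iff the system holds, at each point over which
a unit normal field is given. -/
theorem fBitension_eq_zero_iff_systemAt (he : e ∈ IsManifold.maximalAtlas (𝓡 2) ∞ M)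
    (he' : e' ∈ IsManifold.maximalAtlas (𝓡 3) ∞ N) (hφ : ContMDiff (𝓡 2) (𝓡 3) ∞ φ)
    (himm : ∀ p, Function.Injective (mfderiv (𝓡 2) (𝓡 3) φ p)) {f : M → ℝ}
    (hf : ContDiffOn ℝ ∞ (f ∘ e.symm) (chartDomain φ e e'))
    {U : Set M} (hU : IsOpen U)
    {ξ : ∀ p : M, TangentSpace (𝓡 3) (φ p)} (hξ : IsUnitNormalOn 2 (metricField h) φ ξ U)
    {p : M} (hp : p ∈ e.source) (hp' : φ p ∈ e'.source) (hpU : p ∈ U) :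
    (∀ a, fBitension (metricInChart (pullbackMetric 2 (metricField h) φ) e)
        (metricInChart (metricField h) e') (f ∘ e.symm) (mapInCharts φ e e') (e p) a = 0) ↔
      SystemAt (metricInChart (pullbackMetric 2 (metricField h) φ) e)
        (metricInChart (metricField h) e') (f ∘ e.symm) (mapInCharts φ e e')
        (fieldInCharts φ ξ e e') (e p) := by
  have hS := isSurfaceOn_fieldInCharts he he' hφ himm hU hξ
  have hx : e p ∈ chartDomain φ e e' ∩ (e.target ∩ e.symm ⁻¹' U) :=
    ⟨mem_chartDomain hp hp', e.map_source hp, by simpa [e.left_inv hp] using hpU⟩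
  rw [← hS.fBitension_eq_zero_iff hx (hf.mono Set.inter_subset_left), funext_iff]
  rfl

end SurfaceInCharts

/-! ### The conformal factor and the biharmonic equations in charts -/

section Conformal

variable {M : Type*} [TopologicalSpace M] [ChartedSpace (Coord 2) M] [IsManifold (𝓡 2) ∞ M]
variable {N : Type*} [TopologicalSpace N] [ChartedSpace (Coord 3) N] [IsManifold (𝓡 3) ∞ N]
variable {e : OpenPartialHomeomorph M (Coord 2)} {e' : OpenPartialHomeomorph N (Coord 3)}
variable {φ : M → N}
  {h : Bundle.ContMDiffRiemannianMetric (𝓡 3) ∞ (Coord 3) (fun q : N => TangentSpace (𝓡 3) q)}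
  {gbar : Bundle.ContMDiffRiemannianMetric (𝓡 2) ∞ (Coord 2)
    (fun p : M => TangentSpace (𝓡 2) p)}
  {lam : M → ℝ}

/-- An immersion sends a nonzero vector to a nonzero vector, and both squared lengths are positive.
-/
theorem sq_pos_of_conformal (himm : ∀ p, Function.Injective (mfderiv (𝓡 2) (𝓡 3) φ p))
    (hconf : ∀ (p : M) (v w : TangentSpace (𝓡 2) p),
      h.inner (φ p) (mfderiv (𝓡 2) (𝓡 3) φ p v) (mfderiv (𝓡 2) (𝓡 3) φ p w)
        = lam p ^ 2 * gbar.inner p v w) (p : M) : 0 < lam p ^ 2 := by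
  let v : TangentSpace (𝓡 2) p := (show Coord 2 from EuclideanSpace.single 0 (1 : ℝ))
  have hv : v ≠ 0 := fun h0 => by
    have : (EuclideanSpace.single 0 (1 : ℝ) : Coord 2) = 0 := h0
    simp at this
  have h1 := h.pos (φ p) (mfderiv (𝓡 2) (𝓡 3) φ p v)
    fun h0 => hv (himm p (h0.trans (map_zero _).symm))
  rw [hconf] at h1
  exact (pos_iff_pos_of_mul_pos h1).2 (gbar.pos p v hv)

theorem metricInChart_conformal
    (hconf : ∀ (p : M) (v w : TangentSpace (𝓡 2) p),
      h.inner (φ p) (mfderiv (𝓡 2) (𝓡 3) φ p v) (mfderiv (𝓡 2) (𝓡 3) φ p w)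
        = lam p ^ 2 * gbar.inner p v w) (x : Coord 2) :
    metricInChart (pullbackMetric 2 (metricField h) φ) e x
      = ((fun p => lam p ^ 2) ∘ e.symm) x • metricInChart (metricField gbar) e x := by
  ext i j
  exact hconf _ _ _

/-- No regularity of `lam` is assumed; its square is the quotient of the `(0,0)` entries of two
smooth metrics. -/
theorem contDiffOn_conformal_factor (he : e ∈ IsManifold.maximalAtlas (𝓡 2) ∞ M)
    (he' : e' ∈ IsManifold.maximalAtlas (𝓡 3) ∞ N) (hφ : ContMDiff (𝓡 2) (𝓡 3) ∞ φ)
    (himm : ∀ p, Function.Injective (mfderiv (𝓡 2) (𝓡 3) φ p))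
    (hconf : ∀ (p : M) (v w : TangentSpace (𝓡 2) p),
      h.inner (φ p) (mfderiv (𝓡 2) (𝓡 3) φ p v) (mfderiv (𝓡 2) (𝓡 3) φ p w)
        = lam p ^ 2 * gbar.inner p v w) :
    ContDiffOn ℝ ∞ ((fun p => lam p ^ 2) ∘ e.symm) (chartDomain φ e e') := by
  have hG := (isMetricOn_metricInChart he gbar).mono
    (isSmoothMapOn_mapInCharts he he' hφ).isOpen fun _ hx => hx.1
  have hG' := isMetricOn_pullback (h := h) he he' hφ himm
  have hne : ∀ x ∈ chartDomain φ e e', metricInChart (metricField gbar) e x 0 0 ≠ 0 :=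
    fun x hx => (hG.posDef x hx).diag_pos.ne'
  refine ((hG'.smooth 0 0).div (hG.smooth 0 0) hne).congr fun x hx => ?_
  exact (eq_div_iff (hne x hx)).2 (hconf _ _ _).symm

/-- The bitension field of a conformal immersion vanishes iff the bitension field of the isometric
immersion, weighted with the conformal factor, vanishes. -/
theorem bitension_eq_zero_iff_fBitension_eq_zero
    (he : e ∈ IsManifold.maximalAtlas (𝓡 2) ∞ M)
    (he' : e' ∈ IsManifold.maximalAtlas (𝓡 3) ∞ N) (hφ : ContMDiff (𝓡 2) (𝓡 3) ∞ φ)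
    (himm : ∀ p, Function.Injective (mfderiv (𝓡 2) (𝓡 3) φ p))
    (hconf : ∀ (p : M) (v w : TangentSpace (𝓡 2) p),
      h.inner (φ p) (mfderiv (𝓡 2) (𝓡 3) φ p v) (mfderiv (𝓡 2) (𝓡 3) φ p w)
        = lam p ^ 2 * gbar.inner p v w) {p : M} (hp : p ∈ e.source) (hp' : φ p ∈ e'.source)
    (a : Fin 3) :
    bitension (metricInChart (metricField gbar) e) (metricInChart (metricField h) e')
        (mapInCharts φ e e') (e p) a = 0 ↔
      fBitension (metricInChart (pullbackMetric 2 (metricField h) φ) e)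
        (metricInChart (metricField h) e') ((fun p => lam p ^ 2) ∘ e.symm) (mapInCharts φ e e')
        (e p) a = 0 := by
  have hF := isSmoothMapOn_mapInCharts he he' hφ
  have hG := (isMetricOn_metricInChart he gbar).mono hF.isOpen fun _ hx => hx.1
  have hpos : ∀ x, 0 < ((fun p => lam p ^ 2) ∘ e.symm) x := fun x =>
    sq_pos_of_conformal himm hconf (e.symm x)
  rw [bitension_conformal hG (isMetricOn_pullback he he' hφ himm)
    (isMetricOn_metricInChart he' h) hF (mem_chartDomain hp hp')
    (contDiffOn_conformal_factor he he' hφ himm hconf) (fun x _ => hpos x)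
    fun x _ => metricInChart_conformal hconf x, Pi.smul_apply, smul_eq_mul,
    mul_eq_zero, or_iff_right (hpos _).ne']

end Conformal

end BiharmonicSurface

end

/-! ### The main theorem -/

theorem theorem4p2
    {M : Type*} [TopologicalSpace M] [ChartedSpace (EuclideanSpace ℝ (Fin 2)) M]
    [IsManifold (𝓡 2) ∞ M]
    {N : Type*} [TopologicalSpace N] [ChartedSpace (EuclideanSpace ℝ (Fin 3)) N]
    [IsManifold (𝓡 3) ∞ N]
    (gbar : Bundle.ContMDiffRiemannianMetric (𝓡 2) ∞ (EuclideanSpace ℝ (Fin 2))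
      (fun p : M => TangentSpace (𝓡 2) p))
    (h : Bundle.ContMDiffRiemannianMetric (𝓡 3) ∞ (EuclideanSpace ℝ (Fin 3))
      (fun q : N => TangentSpace (𝓡 3) q))
    (φ : M → N) (hφ : ContMDiff (𝓡 2) (𝓡 3) ∞ φ)
    (hφ_imm : ∀ p, Function.Injective (mfderiv (𝓡 2) (𝓡 3) φ p))
    (lam : M → ℝ)
    (hconf : ∀ (p : M) (v w : TangentSpace (𝓡 2) p),
      h.inner (φ p) (mfderiv (𝓡 2) (𝓡 3) φ p v) (mfderiv (𝓡 2) (𝓡 3) φ p w)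
        = lam p ^ 2 * gbar.inner p v w) :
    -- `φ` is biharmonic iff the surface (with the induced metric) is `lam²`-biharmonic
    (BiharmonicSurface.IsBiharmonic (BiharmonicSurface.metricField gbar)
        (BiharmonicSurface.metricField h) φ ↔
      BiharmonicSurface.IsFBiharmonic (BiharmonicSurface.pullbackMetric 2 (BiharmonicSurface.metricField h) φ)
        (BiharmonicSurface.metricField h)
        (fun p => lam p ^ 2) φ) ∧
    -- this is characterized by the system, for all local unit normal fields
    (BiharmonicSurface.IsFBiharmonic (BiharmonicSurface.pullbackMetric 2 (BiharmonicSurface.metricField h) φ)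
        (BiharmonicSurface.metricField h)
        (fun p => lam p ^ 2) φ ↔
      ∀ (U : Set M) (ξ : ∀ p : M, TangentSpace (𝓡 3) (φ p)), IsOpen U →
        BiharmonicSurface.IsUnitNormalOn 2 (BiharmonicSurface.metricField h) φ ξ U →
          BiharmonicSurface.SystemOn (BiharmonicSurface.pullbackMetric 2 (BiharmonicSurface.metricField h) φ)
        (BiharmonicSurface.metricField h)
            (fun p => lam p ^ 2) φ ξ U) ∧
    -- and, if there is one, for any single global unit normal field
    ∀ ξ : ∀ p : M, TangentSpace (𝓡 3) (φ p),
      BiharmonicSurface.IsUnitNormalOn 2 (BiharmonicSurface.metricField h) φ ξ Set.univ →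
        (BiharmonicSurface.IsFBiharmonic (BiharmonicSurface.pullbackMetric 2 (BiharmonicSurface.metricField h) φ)
        (BiharmonicSurface.metricField h)
            (fun p => lam p ^ 2) φ ↔
          BiharmonicSurface.SystemOn (BiharmonicSurface.pullbackMetric 2 (BiharmonicSurface.metricField h) φ)
        (BiharmonicSurface.metricField h)
            (fun p => lam p ^ 2) φ ξ Set.univ) := by
  have hsys : ∀ (U : Set M) (ξ : ∀ p : M, TangentSpace (𝓡 3) (φ p)), IsOpen U →
      BiharmonicSurface.IsUnitNormalOn 2 (BiharmonicSurface.metricField h) φ ξ U →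
      BiharmonicSurface.IsFBiharmonic
        (BiharmonicSurface.pullbackMetric 2 (BiharmonicSurface.metricField h) φ)
        (BiharmonicSurface.metricField h) (fun p => lam p ^ 2) φ →
      BiharmonicSurface.SystemOn
        (BiharmonicSurface.pullbackMetric 2 (BiharmonicSurface.metricField h) φ)
        (BiharmonicSurface.metricField h) (fun p => lam p ^ 2) φ ξ U :=
    fun U ξ hU hξ hb e he e' he' p hp hp' =>
      (BiharmonicSurface.fBitension_eq_zero_iff_systemAt he he' hφ hφ_imm
        (BiharmonicSurface.contDiffOn_conformal_factor he he' hφ hφ_imm hconf) hU hξ hp.1 hp'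
        hp.2).1 (hb e he e' he' p hp.1 hp')
  refine ⟨?_, ⟨fun hb U ξ hU hξ => hsys U ξ hU hξ hb, fun hs e he e' he' p hp hp' => ?_⟩,
    fun ξ hξ => ⟨hsys _ ξ isOpen_univ hξ, fun hs e he e' he' p hp hp' => ?_⟩⟩
  · constructor
    · exact fun hb e he e' he' p hp hp' a =>
        (BiharmonicSurface.bitension_eq_zero_iff_fBitension_eq_zero he he' hφ hφ_imm hconf hp hp'
          a).1 (hb e he e' he' p hp hp' a)
    · exact fun hb e he e' he' p hp hp' a =>
        (BiharmonicSurface.bitension_eq_zero_iff_fBitension_eq_zero he he' hφ hφ_imm hconf hp hp'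
          a).2 (hb e he e' he' p hp hp' a)
  -- The equation is pointwise, so a unit normal near `p` is enough.
  · obtain ⟨U, ξ, hU, hpU, hξ⟩ := BiharmonicSurface.exists_isUnitNormalOn (h := h) hφ hφ_imm p
    exact (BiharmonicSurface.fBitension_eq_zero_iff_systemAt he he' hφ hφ_imm
      (BiharmonicSurface.contDiffOn_conformal_factor he he' hφ hφ_imm hconf) hU hξ hp hp' hpU).2
      (hs U ξ hU hξ e he e' he' p ⟨hp, hpU⟩ hp')
  · exact (BiharmonicSurface.fBitension_eq_zero_iff_systemAt he he' hφ hφ_imm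
      (BiharmonicSurface.contDiffOn_conformal_factor he he' hφ hφ_imm hconf) isOpen_univ hξ hp hp'
      (Set.mem_univ p)).2 (hs e he e' he' p ⟨hp, Set.mem_univ p⟩ hp')
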